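/- Let $K$ be a field and let $n_1,n_2,n_3,n_4$ be pairwise distinct positive integers with $\gcd(n_1,n_2,n_3,n_4)=1$ and $n_1=\min\{n_1,\dots,n_4\}$. Let $C$ be the monomial curve $x_i=t^{n_i}$ in $\mathbb{A}^4(K)$, let $I(C)\subset K[x_1,\dots,x_4]$ be its toric ideal, i.e. the kernel of $K[x_1,\dots,x_4]\to K[t]$, $x_i\mapsto t^{n_i}$, and let $R=K[[t^{n_1},\dots,t^{n_4}]]$ with maximal ideal $\mathfrak m=\langle t^{n_1},\dots,t^{n_4}\rangle$. Assume that $C$ is Gorenstein (that is, $R$ is a Gorenstein local ring) and not a complete intersection (that is, $I(C)$ cannot be generated by $3$ elements). Let the positive integers $a_i,a_{ij}$ be the exponents in its minimal system of binomial generators: with $a_1=a_{21}+a_{41}$, $a_2=a_{32}+a_{42}$, $a_3=a_{13}+a_{23}$, $a_4=a_{14}+a_{34}$, the ideal $I(C)$ is minimally generated by $$x_3^{a_{13}}x_4^{a_{14}}-x_1^{a_1},\quad x_2^{a_2}-x_1^{a_{21}}x_3^{a_{23}},\quad x_3^{a_3}-x_2^{a_{32}}x_4^{a_{34}},\quad x_4^{a_4}-x_1^{a_{41}}x_2^{a_{42}},\quad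 x_2^{a_{42}}x_3^{a_{13}}-x_1^{a_{21}}x_4^{a_{34}}.$$ Let $d=\min\big(\{i\in\mathbb N : a_2-ia_{32}\le 0\}\cup\{i\in\mathbb N : a_4-ia_{34}\le 0\}\big)$. For $0\ne f\in I(C)$ let $f_*$ be the nonzero homogeneous summand of $f$ of least degree, let $I(C)_*$ be the ideal of $K[x_1,\dots,x_4]$ generated by all $f_*$ with $0\ne f\in I(C)$, and let $\mu(I(C)_*)$ be its minimal number of generators. Suppose that the associated graded ring $\mathrm{gr}_{\mathfrak m}(R)=\bigoplus_{i\ge0}\mathfrak m^i/\mathfrak m^{i+1}$ is Cohen–Macaulay. 1. If $a_3\le a_{32}+a_{34}$, then $\mu(I(C)_*)=5$. 2. If $a_3>a_{32}+a_{34}$, then $\mu(I(C)_*)=2d+2$. -/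

import Mathlib

open CategoryTheory

noncomputable section

namespace MonomialCurve

/-! ### Monomial curves and their tangent cones -/

/-- The toric ideal `I(C)` of the monomial curve `x_i = t ^ n_i`: the kernel of the `K`-algebra
homomorphism `K[x_1, …, x_r] → K[t]`, `x_i ↦ t ^ n_i`. -/
def toricIdeal (K : Type*) [Field K] {r : ℕ} (n : Fin r → ℕ) : Ideal (MvPolynomial (Fin r) K) :=
  RingHom.ker (MvPolynomial.aeval (fun i => (Polynomial.X : Polynomial K) ^ n i) :
    MvPolynomial (Fin r) K →ₐ[K] Polynomial K)

/-- `f_*`: the nonzero homogeneous summand of `f` of least degree (and `0` if `f = 0`). -/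
def leastForm {K : Type*} [Field K] {r : ℕ} (f : MvPolynomial (Fin r) K) :
    MvPolynomial (Fin r) K :=
  MvPolynomial.homogeneousComponent
    (sInf {k : ℕ | MvPolynomial.homogeneousComponent k f ≠ 0}) f

/-- `I_*`: the ideal generated by the forms `f_*` for `f ∈ I`. -/
def tangentConeIdeal {K : Type*} [Field K] {r : ℕ} (I : Ideal (MvPolynomial (Fin r) K)) :
    Ideal (MvPolynomial (Fin r) K) :=
  Ideal.span {g | ∃ f ∈ I, g = leastForm f}

/-- The curve is a complete intersection: its ideal, which has height `r - 1`, can be generated by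
`r - 1` elements. -/
def IsCompleteIntersection (K : Type*) [Field K] {r : ℕ} (n : Fin r → ℕ) : Prop :=
  ∃ f : Fin (r - 1) → MvPolynomial (Fin r) K, Ideal.span (Set.range f) = toricIdeal K n

/-! ### The local ring of the curve and its associated graded ring -/

/-- The ring `R = K[[t ^ n_1, …, t ^ n_r]]`, as a subalgebra of `K[[t]]`: the power series all of
whose exponents lie in the semigroup generated by `n_1, …, n_r`. -/
def localRing (K : Type*) [Field K] {r : ℕ} (n : Fin r → ℕ) : Subalgebra K (PowerSeries K) where
  carrier := {f | ∀ k, PowerSeries.coeff k f ≠ 0 → k ∈ AddSubmonoid.closure (Set.range n)}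
  mul_mem' := by
    intro f g hf hg k hk
    rw [PowerSeries.coeff_mul] at hk
    obtain ⟨p, hp, hne⟩ := Finset.exists_ne_zero_of_sum_ne_zero hk
    rw [← Finset.HasAntidiagonal.mem_antidiagonal.mp hp]
    exact add_mem (hf _ (left_ne_zero_of_mul hne)) (hg _ (right_ne_zero_of_mul hne))
  add_mem' := by
    intro f g hf hg k hk
    by_cases h : PowerSeries.coeff k f = 0
    · refine hg k fun h' => hk ?_
      rw [map_add, h, h', add_zero]
    · exact hf k h
  algebraMap_mem' := by
    intro c k hk
    by_cases h : k = 0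
    · rw [h]
      exact zero_mem _
    · refine absurd ?_ hk
      rw [PowerSeries.algebraMap_apply, Algebra.algebraMap_self, RingHom.id_apply,
        PowerSeries.coeff_C, if_neg h]

/-- The element `t ^ n_i` of `R`. -/
def tPow (K : Type*) [Field K] {r : ℕ} (n : Fin r → ℕ) (i : Fin r) : localRing K n :=
  ⟨PowerSeries.X ^ n i, by
    intro k hk
    rw [PowerSeries.coeff_X_pow] at hk
    have h : k = n i := by
      by_contra h
      exact hk (if_neg h)
    rw [h]
    exact AddSubmonoid.subset_closure (Set.mem_range_self i)⟩

/-- The maximal ideal `𝔪 = ⟨t ^ n_1, …, t ^ n_r⟩` of `R`. -/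
def maxIdeal (K : Type*) [Field K] {r : ℕ} (n : Fin r → ℕ) : Ideal (localRing K n) :=
  Ideal.span (Set.range (tPow K n))

end MonomialCurve

/-- The associated graded ring `gr_I(A) = ⨁ I ^ i / I ^ (i + 1)`, presented as the quotient
`A[It] / I A[It]` of the Rees algebra `A[It] = ⨁ I ^ i t ^ i`; its component of degree `i` is
`I ^ i / I · I ^ i`. -/
abbrev AssocGradedRing {A : Type*} [CommRing A] (I : Ideal A) : Type _ :=
  reesAlgebra I ⧸ I.map (algebraMap A (reesAlgebra I))

/-- A Gorenstein local ring: a Noetherian local ring that has finite injective dimension as a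
module over itself. -/
def IsGorensteinLocalRing (A : Type*) [CommRing A] : Prop :=
  IsNoetherianRing A ∧ IsLocalRing A ∧ ∃ m : ℕ, HasInjectiveDimensionLE (ModuleCat.of A A) m

/-- A Cohen–Macaulay local ring: a Noetherian local ring whose maximal ideal contains a regular
sequence of length equal to the Krull dimension. -/
def IsCohenMacaulayLocalRing (A : Type*) [CommRing A] [IsLocalRing A] : Prop :=
  IsNoetherianRing A ∧ ∃ rs : List A, (∀ x ∈ rs, x ∈ IsLocalRing.maximalIdeal A) ∧
    RingTheory.Sequence.IsRegular A rs ∧ (rs.length : WithBot ℕ∞) = ringKrullDim A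

/-- A Cohen–Macaulay ring: a Noetherian ring whose localizations at all maximal ideals are
Cohen–Macaulay local rings. -/
def IsCohenMacaulayRing (A : Type*) [CommRing A] : Prop :=
  IsNoetherianRing A ∧ ∀ (P : Ideal A) [P.IsMaximal],
    IsCohenMacaulayLocalRing (Localization.AtPrime P)

/-- The family `f` minimally generates the ideal `I`: it generates `I`, and no longer does so
after any one member is left out. -/
def MinimallyGenerates {A ι : Type*} [CommRing A] (f : ι → A) (I : Ideal A) : Prop :=
  Ideal.span (Set.range f) = I ∧ ∀ i, Ideal.span (f '' {i}ᶜ) ≠ I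

namespace MonomialCurve

/-! ### The exponents `a_i`, `a_{ij}` of the minimal generators -/

/-- Positive exponents `a_{ij}`. The exponents `a_1, …, a_4` are the sums defined below. -/
structure Exponents where
  (a13 a14 a21 a23 a32 a34 a41 a42 : ℕ)
  a13_pos : 0 < a13
  a14_pos : 0 < a14
  a21_pos : 0 < a21
  a23_pos : 0 < a23
  a32_pos : 0 < a32
  a34_pos : 0 < a34
  a41_pos : 0 < a41
  a42_pos : 0 < a42

namespace Exponents

variable (a : Exponents)

/-- `a_1 = a_21 + a_41` -/
def a1 : ℕ := a.a21 + a.a41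

/-- `a_2 = a_32 + a_42` -/
def a2 : ℕ := a.a32 + a.a42

/-- `a_3 = a_13 + a_23` -/
def a3 : ℕ := a.a13 + a.a23

/-- `a_4 = a_14 + a_34` -/
def a4 : ℕ := a.a14 + a.a34

/-- `d = min ({i ∈ ℕ | a_2 - i a_32 ≤ 0} ∪ {i ∈ ℕ | a_4 - i a_34 ≤ 0})`. -/
def d : ℕ :=
  sInf ({i : ℕ | (a.a2 : ℤ) - i * a.a32 ≤ 0} ∪ {i : ℕ | (a.a4 : ℤ) - i * a.a34 ≤ 0})

open MvPolynomial in
/-- The five binomials `f_1, …, f_5`; the variables `x_1, …, x_4` are `X 0, …, X 3`. -/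
def binomials (K : Type*) [Field K] : Fin 5 → MvPolynomial (Fin 4) K :=
  ![X 2 ^ a.a13 * X 3 ^ a.a14 - X 0 ^ a.a1,
    X 1 ^ a.a2 - X 0 ^ a.a21 * X 2 ^ a.a23,
    X 2 ^ a.a3 - X 1 ^ a.a32 * X 3 ^ a.a34,
    X 3 ^ a.a4 - X 0 ^ a.a41 * X 1 ^ a.a42,
    X 1 ^ a.a42 * X 2 ^ a.a13 - X 0 ^ a.a21 * X 3 ^ a.a34]

end Exponents

end MonomialCurve

end

noncomputable section

/-! Give an exponent vector `u` its weight, the exponent of `t` in the image of `x ^ u`, and its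
degree. The order of `t ^ s` in `R` is the largest degree of a vector of weight `s`, so both gr and
the tangent cone are governed by the top degrees in the fibres of the weight. Cohen–Macaulayness
enters once: it makes the initial form of `t ^ n_1` a nonzerodivisor, so adding `n_1` raises the
order by exactly one (`IsOrderCompatible`). Hence `x_1` is a nonzerodivisor modulo `orderIdeal`, an
ideal containing I(C)_*. By graded Nakayama, homogeneous elements of I(C)_* that generate
`orderIdeal` modulo `x_1` generate it outright, and the two ideals coincide. Minimality follows from
coefficient functionals that vanish on (x_1, …, x_4) times the ideal and are dual to the chosen
generators. `IsOrderCompatible.spanFinrank_tangentConeIdeal` combines the two bounds. Modulo `x_1`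
only f_3 keeps both its terms. The vectors with the weight of a normal form therefore form a chain,
along which x_2^{a_32} x_4^{a_34} is traded for x_3^{a_3} (`IsStd.red_of_wt_eq`); each trade changes
the degree by a_3 - a_32 - a_34. If this is negative, the normal form is the unique vector of top
degree and the five leading monomials lift to generators. If it is zero, the homogeneous f_3 itself
serves in place of a lift of x_3^{a_3}. If it is positive, the last vector of the chain is on top,
and the monomials that are not such last vectors are generated by 2d + 2 monomials. -/

/-! ### Nonzerodivisors in Cohen–Macaulay rings -/

/-- Every element of `M` has a power killing `z`. If the maximal regular sequence of `A_M` is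
nonempty, its first member also has a power killing `z`, so `z` vanishes in `A_M`. An empty sequence
would mean dimension zero and make `x` nilpotent in `A_M`, against `hpow`. -/
lemma IsCohenMacaulayRing.eq_zero_of_mul_eq_zero {A : Type*} [CommRing A]
    (hCM : IsCohenMacaulayRing A) (M : Ideal A) [hM : M.IsMaximal] {x : A} (hxM : x ∈ M)
    (hrad : ∀ y ∈ M, ∃ N, y ^ N ∈ Ideal.span {x}) (hpow : ∀ s ∉ M, ∀ k, s * x ^ k ≠ 0)
    {z : A} (hz : x * z = 0) : z = 0 := by
  have hann : ∀ y ∈ M, ∃ N, y ^ N * z = 0 := by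
    intro y hy
    obtain ⟨N, hN⟩ := hrad y hy
    obtain ⟨w, hw⟩ := Ideal.mem_span_singleton'.mp hN
    exact ⟨N, by rw [← hw, mul_assoc, hz, mul_zero]⟩
  obtain ⟨-, rs, hrs, hreg, hlen⟩ := hCM.2 M
  have hloc : algebraMap A (Localization.AtPrime M) z = 0 := by
    cases rs with
    | nil =>
      exfalso
      have h0 : Ring.KrullDimLE 0 (Localization.AtPrime M) := by
        rw [ringKrullDimZero_iff_ringKrullDim_eq_zero, ← hlen]
        simp
      have hx : IsNilpotent (algebraMap A (Localization.AtPrime M) x) := by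
        rw [Ring.KrullDimLE.isNilpotent_iff_mem_maximalIdeal]
        exact (IsLocalization.AtPrime.to_map_mem_maximal_iff _ M x).mpr hxM
      obtain ⟨k, hk⟩ := hx
      rw [← map_pow, IsLocalization.map_eq_zero_iff M.primeCompl] at hk
      obtain ⟨s, hs⟩ := hk
      exact hpow s s.2 k hs
    | cons y rs =>
      have hy := ((RingTheory.Sequence.isRegular_cons_iff _ _ _).mp hreg).1
      obtain ⟨⟨y', u⟩, hu⟩ := IsLocalization.surj M.primeCompl y
      have hyM : y' ∈ M := by
        rw [← IsLocalization.AtPrime.to_map_mem_maximal_iff (Localization.AtPrime M) M, ← hu]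
        exact Ideal.mul_mem_right _ _ (hrs y (by simp))
      obtain ⟨N, hN⟩ := hann y' hyM
      have h2 : y ^ N * algebraMap A (Localization.AtPrime M) z = 0 := by
        have h3 := congrArg (algebraMap A (Localization.AtPrime M)) hN
        rw [map_mul, map_pow, map_zero] at h3
        simp only at hu
        rw [← hu, mul_pow, mul_right_comm] at h3
        exact (IsUnit.mul_left_eq_zero ((IsLocalization.map_units _ u).pow N)).mp h3
      have hyN := hy.pow N
      exact hyN (by simpa using h2)
  rw [IsLocalization.map_eq_zero_iff M.primeCompl] at hloc
  obtain ⟨s, hs⟩ := hloc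
  obtain ⟨t, m, hm, htm⟩ := (Ideal.IsMaximal.exists_inv hM s.2)
  obtain ⟨N, hN⟩ := hann m hm
  have h1 : (t * s) * z = 0 := by rw [mul_assoc, hs, mul_zero]
  -- As `t * s` kills `z` and `t * s + m = 1`, multiplication by `m` fixes `z`; but some power of
  -- `m` kills it.
  have key : ∀ k, m ^ k * z = z := by
    intro k
    induction k with
    | zero => simp
    | succ k ih =>
      calc m ^ (k + 1) * z = m ^ k * ((t * s + m) * z) - m ^ k * ((t * s) * z) := by ring
        _ = z := by rw [htm, h1, one_mul, ih, mul_zero, sub_zero]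
  rw [← key N, hN]

/-! ### Weights and the powers of the maximal ideal -/

namespace MonomialCurve

variable {K : Type*} [Field K] {r : ℕ} {n : Fin r → ℕ}

/-- The weight `∑ u_i n_i` of an exponent vector. -/
def wt (n : Fin r → ℕ) (u : Fin r →₀ ℕ) : ℕ := ∑ i, u i * n i

lemma wt_zero : wt n 0 = 0 := by simp [wt]

lemma wt_add (u v : Fin r →₀ ℕ) : wt n (u + v) = wt n u + wt n v := by
  simp [wt, add_mul, Finset.sum_add_distrib]

lemma wt_single (i : Fin r) (k : ℕ) : wt n (Finsupp.single i k) = k * n i := by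
  simp [wt, Finsupp.single_apply]

lemma exists_wt_eq_of_mem_closure {k : ℕ} (hk : k ∈ AddSubmonoid.closure (Set.range n)) :
    ∃ v, wt n v = k := by
  induction hk using AddSubmonoid.closure_induction with
  | mem x hx =>
    obtain ⟨i, rfl⟩ := hx
    exact ⟨Finsupp.single i 1, by simp [wt_single]⟩
  | zero => exact ⟨0, wt_zero⟩
  | add x y _ _ hx hy =>
    obtain ⟨v, rfl⟩ := hx
    obtain ⟨w, rfl⟩ := hy
    exact ⟨v + w, wt_add v w⟩

/-- With `tMon_mem`, this identifies the order of `t ^ s` as the largest degree of a vector of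
weight `s`. The property is additive in `f`, and under products the degrees add. -/
lemma coeff_of_mem_maxIdeal_pow {k : ℕ} {f : localRing K n} (hf : f ∈ maxIdeal K n ^ k) :
    ∀ j, PowerSeries.coeff j (f : PowerSeries K) ≠ 0 → ∃ v, wt n v = j ∧ k ≤ v.degree := by
  have hadd : ∀ (k : ℕ) (f g : localRing K n),
      (∀ j, PowerSeries.coeff j (f : PowerSeries K) ≠ 0 → ∃ v, wt n v = j ∧ k ≤ v.degree) →
      (∀ j, PowerSeries.coeff j (g : PowerSeries K) ≠ 0 → ∃ v, wt n v = j ∧ k ≤ v.degree) →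
      ∀ j, PowerSeries.coeff j ((f + g : localRing K n) : PowerSeries K) ≠ 0 →
        ∃ v, wt n v = j ∧ k ≤ v.degree := by
    intro k f g hf hg j hj
    by_cases h : PowerSeries.coeff j (f : PowerSeries K) = 0
    · refine hg j fun h' => hj ?_
      simp [h, h']
    · exact hf j h
  have hmul : ∀ (k l : ℕ) (f g : localRing K n),
      (∀ j, PowerSeries.coeff j (f : PowerSeries K) ≠ 0 → ∃ v, wt n v = j ∧ k ≤ v.degree) →
      (∀ j, PowerSeries.coeff j (g : PowerSeries K) ≠ 0 → ∃ v, wt n v = j ∧ l ≤ v.degree) →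
      ∀ j, PowerSeries.coeff j ((f * g : localRing K n) : PowerSeries K) ≠ 0 →
        ∃ v, wt n v = j ∧ k + l ≤ v.degree := by
    intro k l f g hf hg j hj
    rw [Subalgebra.coe_mul, PowerSeries.coeff_mul] at hj
    obtain ⟨p, hp, hne⟩ := Finset.exists_ne_zero_of_sum_ne_zero hj
    obtain ⟨v, hv, hv'⟩ := hf _ (left_ne_zero_of_mul hne)
    obtain ⟨w, hw, hw'⟩ := hg _ (right_ne_zero_of_mul hne)
    refine ⟨v + w, ?_, ?_⟩
    · rw [← Finset.HasAntidiagonal.mem_antidiagonal.mp hp, ← hv, ← hw, wt_add]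
    · rw [map_add]; omega
  have hzero : ∀ f : localRing K n, ∀ j, PowerSeries.coeff j (f : PowerSeries K) ≠ 0 →
      ∃ v, wt n v = j ∧ 0 ≤ v.degree := by
    intro f j hj
    obtain ⟨v, hv⟩ := exists_wt_eq_of_mem_closure (f.2 j hj)
    exact ⟨v, hv, Nat.zero_le _⟩
  have hone : ∀ f ∈ maxIdeal K n, ∀ j, PowerSeries.coeff j (f : PowerSeries K) ≠ 0 →
      ∃ v, wt n v = j ∧ 1 ≤ v.degree := by
    intro f hf
    refine Submodule.span_induction ?_ ?_ ?_ ?_ hf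
    · rintro _ ⟨i, rfl⟩ j hj
      refine ⟨Finsupp.single i 1, ?_, by simp⟩
      by_contra h
      apply hj
      simp only [tPow, PowerSeries.coeff_X_pow]
      rw [if_neg]
      rintro rfl
      simp [wt_single] at h
    · intro j hj; simp at hj
    · intro f g _ _; exact hadd 1 f g
    · intro c f _ hf
      have := hmul 0 1 c f (hzero c) hf
      rwa [zero_add] at this
  induction k generalizing f with
  | zero => exact hzero f
  | succ k ih =>
    rw [pow_succ] at hf
    refine Submodule.mul_induction_on hf ?_ ?_
    · intro f hf g hg
      exact hmul k 1 f g (ih hf) (hone g hg)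
    · intro f g; exact hadd (k + 1) f g

/-- The element `t ^ k` of `R` for `k` the weight of `v`. -/
def tMon (K : Type*) [Field K] (n : Fin r → ℕ) (v : Fin r →₀ ℕ) : localRing K n :=
  ∏ i, tPow K n i ^ v i

lemma coe_tMon (v : Fin r →₀ ℕ) :
    (tMon K n v : PowerSeries K) = PowerSeries.X ^ wt n v := by
  rw [tMon, SubmonoidClass.coe_finsetProd, wt, ← Finset.prod_pow_eq_pow_sum]
  refine Finset.prod_congr rfl fun i _ => ?_
  rw [Subalgebra.coe_pow, tPow, ← pow_mul, mul_comm]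

lemma tMon_mem (v : Fin r →₀ ℕ) : tMon K n v ∈ maxIdeal K n ^ v.degree := by
  rw [tMon, Finsupp.degree_eq_sum, ← Finset.prod_pow_eq_pow_sum]
  exact Ideal.prod_mem_prod fun i _ =>
    Ideal.pow_mem_pow (Ideal.subset_span (Set.mem_range_self i)) _

lemma tPow_mem (i : Fin r) : tPow K n i ∈ maxIdeal K n :=
  Ideal.subset_span (Set.mem_range_self i)

lemma exists_wt_add_of_mem_closure {k : ℕ} (hk : k ∈ AddSubmonoid.closure (Set.range n))
    (h0 : k ≠ 0) : ∃ i, ∃ s ∈ AddSubmonoid.closure (Set.range n), k = s + n i := by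
  induction hk using AddSubmonoid.closure_induction with
  | mem x hx =>
    obtain ⟨i, rfl⟩ := hx
    exact ⟨i, 0, zero_mem _, by simp⟩
  | zero => exact absurd rfl h0
  | add x y hx' hy' hx hy =>
    by_cases h : x = 0
    · subst h
      rw [zero_add] at h0 ⊢
      exact hy h0
    · obtain ⟨i, s, hs, rfl⟩ := hx h
      exact ⟨i, s + y, add_mem hs hy', by ring⟩

/-- A power series has infinitely many terms but there are finitely many generators: assign to each
exponent in the support one generator that can be split off, and group the terms by it. -/
lemma mem_maxIdeal_of_constantCoeff (f : localRing K n)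
    (hf : PowerSeries.coeff 0 (f : PowerSeries K) = 0) : f ∈ maxIdeal K n := by
  classical
  have hch : ∀ k : ℕ, ∃ i : Option (Fin r), PowerSeries.coeff k (f : PowerSeries K) ≠ 0 →
      ∃ i', i = some i' ∧ ∃ s ∈ AddSubmonoid.closure (Set.range n), k = s + n i' := by
    intro k
    by_cases h : PowerSeries.coeff k (f : PowerSeries K) = 0
    · exact ⟨none, fun h' => absurd h h'⟩
    · obtain ⟨i, hi⟩ := exists_wt_add_of_mem_closure (f.2 k h) (by rintro rfl; exact h hf)
      exact ⟨some i, fun _ => ⟨i, rfl, hi⟩⟩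
  choose ch hch using hch
  let g : Fin r → localRing K n := fun i =>
    ⟨PowerSeries.mk fun j => if ch (j + n i) = some i then
      PowerSeries.coeff (j + n i) (f : PowerSeries K) else 0, by
      intro k hk
      rw [PowerSeries.coeff_mk] at hk
      have h1 : ch (k + n i) = some i := by
        by_contra h
        exact hk (if_neg h)
      rw [if_pos h1] at hk
      obtain ⟨i', hi', s, hs, hks⟩ := hch _ hk
      rw [h1, Option.some_inj] at hi'
      subst hi'
      rwa [Nat.add_right_cancel hks]⟩
  have hfg : f = ∑ i, g i * tPow K n i := by
    apply Subtype.ext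
    ext k
    rw [AddSubmonoidClass.coe_finsetSum, map_sum]
    have hterm : ∀ i, PowerSeries.coeff k ((g i * tPow K n i : localRing K n) : PowerSeries K) =
        if ch k = some i then PowerSeries.coeff k (f : PowerSeries K) else 0 := by
      intro i
      rw [Subalgebra.coe_mul]
      simp only [tPow, PowerSeries.coeff_mul_X_pow']
      by_cases hk : n i ≤ k
      · rw [if_pos hk]
        simp only [g, PowerSeries.coeff_mk, Nat.sub_add_cancel hk]
      · rw [if_neg hk]
        symm
        rw [ite_eq_right_iff]
        intro h
        by_contra h0
        obtain ⟨i', hi', s, hs, hks⟩ := hch _ h0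
        rw [h, Option.some_inj] at hi'
        subst hi'
        omega
    rw [Finset.sum_congr rfl fun i _ => hterm i]
    by_cases h0 : PowerSeries.coeff k (f : PowerSeries K) = 0
    · simp [h0]
    · obtain ⟨i', hi', -⟩ := hch _ h0
      simp [hi']
  rw [hfg]
  exact Ideal.sum_mem _ fun i _ => Ideal.mul_mem_left _ _ (tPow_mem i)

end MonomialCurve

/-! ### Initial forms in the associated graded ring -/

namespace AssocGradedRing

variable {A : Type*} [CommRing A] (I : Ideal A)

/-- The initial form of degree `k` of an element of `I ^ k`. -/
def form (k : ℕ) (c : A) (hc : c ∈ I ^ k) : AssocGradedRing I :=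
  Ideal.Quotient.mk _ ⟨Polynomial.monomial k c, reesAlgebra.monomial_mem.mpr hc⟩

variable {I}

lemma form_mul {k l : ℕ} {c e : A} (hc : c ∈ I ^ k) (he : e ∈ I ^ l)
    (hce : c * e ∈ I ^ (k + l)) : form I k c hc * form I l e he = form I (k + l) (c * e) hce := by
  rw [form, form, form, ← map_mul]
  congr 1
  exact Subtype.ext (Polynomial.monomial_mul_monomial k l c e)

lemma form_add {k : ℕ} {c e : A} (hc : c ∈ I ^ k) (he : e ∈ I ^ k) :
    form I k (c + e) (add_mem hc he) = form I k c hc + form I k e he := by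
  rw [form, form, form, ← map_add]
  congr 1
  exact Subtype.ext (map_add (Polynomial.monomial k) c e)

lemma form_congr {k l : ℕ} {c e : A} (hc : c ∈ I ^ k) (h : k = l) (h' : c = e) :
    form I k c hc = form I l e (h ▸ h' ▸ hc) := by
  subst h h'; rfl

lemma form_pow {k : ℕ} {c : A} (hc : c ∈ I ^ k) (m : ℕ) :
    form I k c hc ^ m = form I (k * m) (c ^ m) (by rw [pow_mul]; exact Ideal.pow_mem_pow hc m) := by
  rw [form, form, ← map_pow]
  congr 1
  exact Subtype.ext (Polynomial.monomial_pow (r := c) k m)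

lemma coeff_mem_of_mem_map {f : reesAlgebra I} (hf : f ∈ I.map (algebraMap A (reesAlgebra I)))
    (i : ℕ) : (f : Polynomial A).coeff i ∈ I ^ (i + 1) := by
  induction hf using Submodule.span_induction generalizing i with
  | mem x hx =>
    obtain ⟨c, hc, rfl⟩ := hx
    rw [Subalgebra.coe_algebraMap, Polynomial.algebraMap_apply, Polynomial.coeff_C]
    split_ifs with h
    · subst h; simpa using hc
    · exact zero_mem _
  | zero => simp
  | add x y _ _ hx hy =>
    rw [Subalgebra.coe_add, Polynomial.coeff_add]
    exact add_mem (hx i) (hy i)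
  | smul g x _ hx =>
    rw [smul_eq_mul, Subalgebra.coe_mul, Polynomial.coeff_mul]
    refine Ideal.sum_mem _ fun p hp => ?_
    rw [← Finset.HasAntidiagonal.mem_antidiagonal.mp hp, add_assoc, pow_add]
    exact Ideal.mul_mem_mul ((mem_reesAlgebra_iff I _).mp g.2 _) (hx _)

lemma form_eq_zero_iff {k : ℕ} {c : A} (hc : c ∈ I ^ k) :
    form I k c hc = 0 ↔ c ∈ I ^ (k + 1) := by
  constructor
  · intro h
    rw [form, Ideal.Quotient.eq_zero_iff_mem] at h
    simpa using coeff_mem_of_mem_map h k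
  · intro h
    rw [pow_succ'] at h
    have key : ∃ h' : c ∈ I ^ k, form I k c h' = 0 := by
      refine Submodule.mul_induction_on h ?_ ?_
      · intro x hx y hy
        have h' := Ideal.mul_mem_left (I ^ k) x hy
        refine ⟨h', ?_⟩
        rw [form, Ideal.Quotient.eq_zero_iff_mem]
        have : (⟨Polynomial.monomial k (x * y), reesAlgebra.monomial_mem.mpr h'⟩ :
            reesAlgebra I) = algebraMap A (reesAlgebra I) x *
              ⟨Polynomial.monomial k y, reesAlgebra.monomial_mem.mpr hy⟩ := by
          apply Subtype.ext
          rw [Subalgebra.coe_mul, Subalgebra.coe_algebraMap, Polynomial.algebraMap_apply,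
            Polynomial.C_mul_monomial]
          rfl
        rw [this]
        exact Ideal.mul_mem_right _ _ (Ideal.mem_map_of_mem _ hx)
      · rintro x y ⟨hx', hx⟩ ⟨hy', hy⟩
        exact ⟨add_mem hx' hy', by rw [form_add hx' hy', hx, hy, add_zero]⟩
    exact key.2

end AssocGradedRing

/-! ### The initial form of t^{n_1} and the order function -/

namespace MonomialCurve
open AssocGradedRing

variable {K : Type*} [Field K] {r : ℕ} {n : Fin r → ℕ}

/-- The augmentation of the associated graded ring onto the residue field. -/
def augmentation (hpos : ∀ i, 0 < n i) : AssocGradedRing (maxIdeal K n) →+* K :=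
  Ideal.Quotient.lift _
    ((PowerSeries.constantCoeff (R := K)).comp <| (localRing K n).val.toRingHom.comp <|
      Polynomial.constantCoeff.comp (reesAlgebra (maxIdeal K n)).val.toRingHom) <| by
    intro f hf
    have h := coeff_mem_of_mem_map hf 0
    rw [zero_add] at h
    change PowerSeries.constantCoeff (((f : Polynomial (localRing K n)).coeff 0 : localRing K n) :
      PowerSeries K) = 0
    rw [← PowerSeries.coeff_zero_eq_constantCoeff_apply]
    by_contra h0
    obtain ⟨v, hv, hv'⟩ := coeff_of_mem_maxIdeal_pow h 0 h0
    rw [Finsupp.degree_eq_sum] at hv'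
    obtain ⟨i, -, hi⟩ := Finset.exists_ne_zero_of_sum_ne_zero (Nat.one_le_iff_ne_zero.mp hv')
    rw [wt, Finset.sum_eq_zero_iff] at hv
    have := hv i (Finset.mem_univ i)
    have := hpos i
    simp_all

lemma augmentation_mk (hpos : ∀ i, 0 < n i) (f : reesAlgebra (maxIdeal K n)) :
    augmentation hpos (Ideal.Quotient.mk _ f) =
      PowerSeries.coeff 0 (((f : Polynomial (localRing K n)).coeff 0 : localRing K n) :
        PowerSeries K) := by
  rw [PowerSeries.coeff_zero_eq_constantCoeff_apply]
  rfl

/-- The initial form of `t ^ n_i`. -/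
def tForm (K : Type*) [Field K] (n : Fin r → ℕ) (i : Fin r) : AssocGradedRing (maxIdeal K n) :=
  form (maxIdeal K n) 1 (tPow K n i) (by rw [pow_one]; exact tPow_mem i)

lemma augmentation_form (hpos : ∀ i, 0 < n i) {k : ℕ} (hk : 0 < k) {c : localRing K n}
    (hc : c ∈ maxIdeal K n ^ k) : augmentation hpos (form _ k c hc) = 0 := by
  rw [form, augmentation_mk]
  simp [Polynomial.coeff_monomial, hk.ne']

lemma coe_tPow_pow (i : Fin r) (k : ℕ) :
    ((tPow K n i ^ k : localRing K n) : PowerSeries K) = PowerSeries.X ^ (n i * k) := by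
  rw [Subalgebra.coe_pow, tPow, ← pow_mul]

lemma mul_degree_le_wt {i₀ : Fin r} (hmin : ∀ i, n i₀ ≤ n i) (v : Fin r →₀ ℕ) :
    n i₀ * v.degree ≤ wt n v := by
  rw [wt, Finsupp.degree_eq_sum, Finset.mul_sum]
  refine Finset.sum_le_sum fun i _ => ?_
  rw [mul_comm]
  exact Nat.mul_le_mul_left _ (hmin i)

/-- The power `t ^ (n_i n_{i₀})` is also the `n_i`-th power of `t ^ n_{i₀}`, hence lies deeper in
the 𝔪-adic filtration than degree `n_{i₀}`. -/
lemma tForm_pow_eq_zero {i₀ i : Fin r} (h : n i₀ < n i) : tForm K n i ^ n i₀ = 0 := by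
  rw [tForm, form_pow, form_eq_zero_iff, one_mul]
  have : tPow K n i ^ n i₀ = tPow K n i₀ ^ n i := by
    apply Subtype.ext
    rw [coe_tPow_pow, coe_tPow_pow, mul_comm]
  rw [this]
  exact Ideal.pow_le_pow_right h (Ideal.pow_mem_pow (tPow_mem i₀) _)

lemma form_mem_radical {i₀ : Fin r} (h : ∀ i, i ≠ i₀ → n i₀ < n i) {k : ℕ} (hk : 0 < k)
    {c : localRing K n} (hc : c ∈ maxIdeal K n ^ k) :
    form _ k c hc ∈ (Ideal.span {tForm K n i₀}).radical := by
  have htF : ∀ i, tForm K n i ∈ (Ideal.span {tForm K n i₀}).radical := by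
    intro i
    by_cases hi : i = i₀
    · subst hi
      exact Ideal.le_radical (Ideal.mem_span_singleton_self _)
    · exact ⟨n i₀, by rw [tForm_pow_eq_zero (h i hi)]; exact zero_mem _⟩
  have hone : ∀ x ∈ maxIdeal K n, ∃ h : x ∈ maxIdeal K n ^ 1,
      form _ 1 x h ∈ (Ideal.span {tForm K n i₀}).radical := by
    intro x hx
    induction hx using Submodule.span_induction with
    | mem x hx =>
      obtain ⟨i, rfl⟩ := hx
      exact ⟨_, htF i⟩
    | zero =>
      refine ⟨zero_mem _, ?_⟩
      rw [(form_eq_zero_iff (zero_mem _)).mpr (zero_mem _)]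
      exact zero_mem _
    | add x y _ _ hx hy =>
      obtain ⟨hx, hx'⟩ := hx
      obtain ⟨hy, hy'⟩ := hy
      exact ⟨add_mem hx hy, by rw [form_add hx hy]; exact add_mem hx' hy'⟩
    | smul g x _ hx =>
      obtain ⟨hx, hx'⟩ := hx
      have h1 : g ∈ maxIdeal K n ^ 0 := by simp
      have h2 : g * x ∈ maxIdeal K n ^ 1 := Ideal.mul_mem_left _ _ hx
      refine ⟨h2, ?_⟩
      have h3 := form_mul h1 hx (by rwa [zero_add])
      rw [form_congr (k := 0 + 1) _ (zero_add 1) rfl] at h3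
      have h4 := Ideal.mul_mem_left _ (form _ 0 g h1) hx'
      rw [h3] at h4
      exact h4
  obtain ⟨k, rfl⟩ : ∃ k', k = k' + 1 := ⟨k - 1, by omega⟩
  have key : ∃ h : c ∈ maxIdeal K n ^ (k + 1),
      form _ (k + 1) c h ∈ (Ideal.span {tForm K n i₀}).radical := by
    have hc' := hc
    rw [pow_succ] at hc'
    refine Submodule.mul_induction_on hc' ?_ ?_
    · intro x hx y hy
      obtain ⟨hy, hy'⟩ := hone y hy
      have h2 : x * y ∈ maxIdeal K n ^ (k + 1) := by
        rw [pow_add]; exact Ideal.mul_mem_mul hx hy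
      exact ⟨h2, by rw [← form_mul hx hy h2]; exact Ideal.mul_mem_left _ _ hy'⟩
    · rintro x y ⟨hx, hx'⟩ ⟨hy, hy'⟩
      exact ⟨add_mem hx hy, by rw [form_add hx hy]; exact add_mem hx' hy'⟩
  exact key.2

lemma mem_radical_of_augmentation_eq_zero {i₀ : Fin r} (hpos : ∀ i, 0 < n i)
    (h : ∀ i, i ≠ i₀ → n i₀ < n i) {y : AssocGradedRing (maxIdeal K n)}
    (hy : augmentation hpos y = 0) : y ∈ (Ideal.span {tForm K n i₀}).radical := by
  obtain ⟨f, rfl⟩ := Ideal.Quotient.mk_surjective y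
  rw [augmentation_mk] at hy
  have hf := (mem_reesAlgebra_iff _ _).mp f.2
  have hsum : (Ideal.Quotient.mk ((maxIdeal K n).map (algebraMap _ (reesAlgebra _))) f :
      AssocGradedRing (maxIdeal K n)) =
      ∑ i ∈ (f : Polynomial (localRing K n)).support, form _ i _ (hf i) := by
    simp only [form]
    rw [← map_sum]
    congr 1
    apply Subtype.ext
    rw [AddSubmonoidClass.coe_finsetSum]
    exact (Polynomial.sum_monomial_eq (f : Polynomial (localRing K n))).symm
  rw [hsum]
  refine Ideal.sum_mem _ fun i _ => ?_
  rcases Nat.eq_zero_or_pos i with rfl | hi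
  · rw [(form_eq_zero_iff _).mpr]
    · exact zero_mem _
    · rw [zero_add, pow_one]
      exact mem_maxIdeal_of_constantCoeff _ hy
  · exact form_mem_radical h hi _

/-- If the product vanished, its degree-`k` coefficient would lie in `𝔪 ^ (k + 1)`. That series has
a nonzero coefficient at `n i₀ * k`, but a vector of this weight has degree at most `k`, because `n
i₀` is least. -/
lemma mul_tForm_pow_ne_zero {i₀ : Fin r} (hpos : ∀ i, 0 < n i) (hmin : ∀ i, n i₀ ≤ n i)
    {s : AssocGradedRing (maxIdeal K n)} (hs : augmentation hpos s ≠ 0) (k : ℕ) :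
    s * tForm K n i₀ ^ k ≠ 0 := by
  obtain ⟨f, rfl⟩ := Ideal.Quotient.mk_surjective s
  rw [augmentation_mk] at hs
  intro h0
  rw [tForm, form_pow, form, ← map_mul, Ideal.Quotient.eq_zero_iff_mem] at h0
  have h := coeff_mem_of_mem_map h0 k
  rw [Subalgebra.coe_mul] at h
  simp only [one_mul] at h
  have h1 := Polynomial.coeff_mul_monomial (f : Polynomial (localRing K n)) k 0
    (tPow K n i₀ ^ k)
  rw [zero_add] at h1
  rw [h1] at h
  obtain ⟨v, hv, hv'⟩ := coeff_of_mem_maxIdeal_pow h (n i₀ * k) (by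
    rw [Subalgebra.coe_mul, coe_tPow_pow, PowerSeries.coeff_mul_X_pow', if_pos le_rfl,
      Nat.sub_self]
    exact hs)
  have h2 := mul_degree_le_wt hmin v
  rw [hv] at h2
  have := Nat.le_of_mul_le_mul_left h2 (hpos i₀)
  omega

/-- If the associated graded ring is Cohen–Macaulay, the initial form of `t ^ n_i`, with `n_i`
least, is a nonzerodivisor. -/
lemma eq_zero_of_tForm_mul_eq_zero {i₀ : Fin r} (hpos : ∀ i, 0 < n i)
    (h : ∀ i, i ≠ i₀ → n i₀ < n i) (hCM : IsCohenMacaulayRing (AssocGradedRing (maxIdeal K n)))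
    {z : AssocGradedRing (maxIdeal K n)} (hz : tForm K n i₀ * z = 0) : z = 0 := by
  have hsurj : Function.Surjective (augmentation (K := K) hpos) := by
    intro c
    refine ⟨Ideal.Quotient.mk _ (algebraMap (localRing K n) _ (algebraMap K _ c)), ?_⟩
    rw [augmentation_mk, Subalgebra.coe_algebraMap, Polynomial.algebraMap_apply,
      Polynomial.coeff_C_zero]
    simp
  have hM : (RingHom.ker (augmentation (K := K) hpos)).IsMaximal :=
    RingHom.ker_isMaximal_of_surjective _ hsurj
  have hmin : ∀ i, n i₀ ≤ n i := fun i => by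
    by_cases hi : i = i₀
    · rw [hi]
    · exact (h i hi).le
  exact hCM.eq_zero_of_mul_eq_zero (RingHom.ker (augmentation hpos))
    (augmentation_form hpos one_pos _)
    (fun y hy => mem_radical_of_augmentation_eq_zero hpos h hy)
    (fun s hs k => mul_tForm_pow_ne_zero hpos hmin hs k) hz

/-- As long as the known order `k` of `t ^ wt u` satisfies `k + 2 ≤ v.degree`, the product of its
degree-`k` form with the form of `t ^ n_{i₀}` is zero. The nonzerodivisor cancels, so the order is
at least `k + 1`. -/
lemma exists_degree_of_isCohenMacaulayRing {i₀ : Fin r} (hpos : ∀ i, 0 < n i)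
    (h : ∀ i, i ≠ i₀ → n i₀ < n i) (hCM : IsCohenMacaulayRing (AssocGradedRing (maxIdeal K n)))
    {u v : Fin r →₀ ℕ} (huv : wt n v = wt n u + n i₀) :
    ∃ u', wt n u' = wt n u ∧ v.degree ≤ u'.degree + 1 := by
  have key : ∀ k, k + 1 ≤ v.degree → ∃ u', wt n u' = wt n u ∧ k ≤ u'.degree := by
    intro k
    induction k with
    | zero => exact fun _ => ⟨u, rfl, Nat.zero_le _⟩
    | succ k ih =>
      intro hk
      obtain ⟨u', hu', hk'⟩ := ih (by omega)
      have hm : tMon K n u' ∈ maxIdeal K n ^ k := Ideal.pow_le_pow_right hk' (tMon_mem u')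
      have hz : tForm K n i₀ * form _ k _ hm = 0 := by
        have h1 : tPow K n i₀ * tMon K n u' = tMon K n v := by
          apply Subtype.ext
          rw [Subalgebra.coe_mul, coe_tMon, coe_tMon, tPow, ← pow_add, huv, hu', add_comm]
        have h2 : tMon K n v ∈ maxIdeal K n ^ (1 + k + 1) :=
          Ideal.pow_le_pow_right (by omega) (tMon_mem v)
        rw [← h1] at h2
        rw [tForm, form_mul _ _ (Ideal.pow_le_pow_right (Nat.le_succ _) h2), form_eq_zero_iff]
        exact h2
      have h3 := (form_eq_zero_iff hm).mp (eq_zero_of_tForm_mul_eq_zero hpos h hCM hz)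
      obtain ⟨u'', hu'', hk''⟩ := coeff_of_mem_maxIdeal_pow h3 (wt n u') (by
        rw [coe_tMon, PowerSeries.coeff_X_pow_self]
        exact one_ne_zero)
      exact ⟨u'', hu''.trans hu', hk''⟩
  rcases Nat.eq_zero_or_pos v.degree with h0 | h0
  · exact ⟨u, rfl, by omega⟩
  · obtain ⟨u', hu', hk⟩ := key (v.degree - 1) (by omega)
    exact ⟨u', hu', by omega⟩

end MonomialCurve

/-! ### Coefficient sums, graded Nakayama, and a lower bound for generators -/

namespace MvPolynomial

variable {σ K : Type*} [Field K]

open Classical in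
/-- The sum of the coefficients of a polynomial at the exponents satisfying `p`. -/
def sumOn (p : (σ →₀ ℕ) → Prop) : MvPolynomial σ K →ₗ[K] K :=
  (basisMonomials σ K).constr K fun u => if p u then 1 else 0

open Classical in
lemma sumOn_monomial (p : (σ →₀ ℕ) → Prop) (u : σ →₀ ℕ) (c : K) :
    sumOn p (monomial u c) = if p u then c else 0 := by
  have h : sumOn p (monomial u (1 : K)) = if p u then 1 else 0 := by
    have := (basisMonomials σ K).constr_basis K (fun u => if p u then (1 : K) else 0) u
    rwa [coe_basisMonomials] at this
  rw [← mul_one c, ← smul_eq_mul, ← smul_monomial, map_smul, h]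
  split_ifs <;> simp

open Classical in
lemma sumOn_eq_sum (p : (σ →₀ ℕ) → Prop) (f : MvPolynomial σ K) :
    sumOn p f = ∑ u ∈ f.support, if p u then f.coeff u else 0 := by
  conv_lhs => rw [f.as_sum, map_sum]
  exact Finset.sum_congr rfl fun u _ => sumOn_monomial p u _

lemma sumOn_congr {p q : (σ →₀ ℕ) → Prop} {f : MvPolynomial σ K}
    (h : ∀ u, coeff u f ≠ 0 → (p u ↔ q u)) : sumOn p f = sumOn q f := by
  classical
  rw [sumOn_eq_sum, sumOn_eq_sum]
  refine Finset.sum_congr rfl fun u hu => ?_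
  simp only [h u (mem_support_iff.mp hu)]

lemma sumOn_eq_zero {p : (σ →₀ ℕ) → Prop} {f : MvPolynomial σ K}
    (h : ∀ u, p u → coeff u f = 0) : sumOn p f = 0 := by
  classical
  rw [sumOn_eq_sum]
  refine Finset.sum_eq_zero fun u _ => ?_
  split_ifs with hp
  · exact h u hp
  · rfl

lemma sumOn_eq_coeff {p : (σ →₀ ℕ) → Prop} {f : MvPolynomial σ K} {u : σ →₀ ℕ} (hu : p u)
    (h : ∀ v, p v → v ≠ u → coeff v f = 0) : sumOn p f = coeff u f := by
  classical
  rw [sumOn_eq_sum, Finset.sum_eq_single u]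
  · rw [if_pos hu]
  · intro v _ hv
    split_ifs with hp
    · exact h v hp hv
    · rfl
  · intro h
    rw [notMem_support_iff.mp h, ite_self]

lemma sumOn_congr_coeff {p : (σ →₀ ℕ) → Prop} {f g : MvPolynomial σ K}
    (h : ∀ u, p u → coeff u f = coeff u g) : sumOn p f = sumOn p g := by
  rw [← sub_eq_zero, ← map_sub]
  refine sumOn_eq_zero fun u hu => ?_
  rw [coeff_sub, h u hu, sub_self]

lemma sumOn_monomial_mul (p : (σ →₀ ℕ) → Prop) (w : σ →₀ ℕ) (f : MvPolynomial σ K) :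
    sumOn p (monomial w 1 * f) = sumOn (fun u => p (w + u)) f := by
  induction f using induction_on' with
  | monomial u c => rw [monomial_mul, one_mul, sumOn_monomial, sumOn_monomial]
  | add f g hf hg => rw [mul_add, map_add, map_add, hf, hg]

lemma sumOn_X_mul (p : (σ →₀ ℕ) → Prop) (i : σ) (f : MvPolynomial σ K) :
    sumOn p (X i * f) = sumOn (fun u => p (Finsupp.single i 1 + u)) f :=
  sumOn_monomial_mul p _ f

lemma homogeneousComponent_succ_X_mul (i : σ) (f : MvPolynomial σ K) (k : ℕ) :
    homogeneousComponent (k + 1) (X i * f) = X i * homogeneousComponent k f := by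
  induction f using induction_on' with
  | monomial u c =>
    have h := isHomogeneous_monomial (σ := σ) c (rfl : u.degree = u.degree)
    rw [homogeneousComponent_of_mem h,
      homogeneousComponent_of_mem (n := 1 + u.degree) ((isHomogeneous_X K i).mul h)]
    split_ifs <;> first | omega | simp
  | add f g hf hg => rw [mul_add, map_add, map_add, hf, hg, mul_add]

lemma homogeneousComponent_zero_X_mul (i : σ) (f : MvPolynomial σ K) :
    homogeneousComponent 0 (X i * f) = 0 := by
  classical
  rw [homogeneousComponent_zero, coeff_X_mul', if_neg (by simp), C_0]

attribute [local instance] MvPolynomial.gradedAlgebra in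
/-- A graded Nakayama lemma for a variable that is a nonzerodivisor modulo `P`. -/
lemma le_span_of_le_sup_span_X {P : Ideal (MvPolynomial σ K)} {i : σ}
    {S : Set (MvPolynomial σ K)} (hS : ∀ g ∈ S, ∃ k, g.IsHomogeneous k)
    (hSP : S ⊆ P) (hPhom : ∀ f ∈ P, ∀ k, homogeneousComponent k f ∈ P)
    (hX : ∀ f, X i * f ∈ P → f ∈ P) (hle : P ≤ Ideal.span S ⊔ Ideal.span {X i}) :
    P ≤ Ideal.span S := by
  have hShom : ∀ f ∈ Ideal.span S, ∀ k, homogeneousComponent k f ∈ Ideal.span S := by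
    exact fun f hf k => homogeneousComponent_mem_of_mem
      (Ideal.homogeneous_span _ S fun g hg => hS g hg) hf k
  have key : ∀ k, ∀ f ∈ P, f.IsHomogeneous k → f ∈ Ideal.span S := by
    intro k
    induction k with
    | zero =>
      intro f hf hfk
      obtain ⟨g, hg, y, hy, hgy⟩ := Submodule.mem_sup.mp (hle hf)
      obtain ⟨q, rfl⟩ := Ideal.mem_span_singleton.mp hy
      rw [← homogeneousComponent_eq_self hfk, ← hgy, map_add, homogeneousComponent_zero_X_mul,
        add_zero]
      exact hShom g hg 0
    | succ k ih =>
      intro f hf hfk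
      obtain ⟨g, hg, y, hy, hgy⟩ := Submodule.mem_sup.mp (hle hf)
      obtain ⟨q, rfl⟩ := Ideal.mem_span_singleton.mp hy
      have hf' : f = homogeneousComponent (k + 1) g + X i * homogeneousComponent k q := by
        rw [← homogeneousComponent_succ_X_mul, ← map_add, hgy, homogeneousComponent_eq_self hfk]
      have hg' := hShom g hg (k + 1)
      -- `X i` times this component is the difference of two elements of `P`; cancelling `X i`
      -- lowers the degree and lets the induction apply.
      have hq : homogeneousComponent k q ∈ P := by
        refine hX _ ?_
        rw [← sub_eq_of_eq_add' hf']
        exact sub_mem hf (Ideal.span_le.mpr hSP hg')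
      rw [hf']
      exact add_mem hg' (Ideal.mul_mem_left _ _
        (ih _ hq (homogeneousComponent_isHomogeneous k q)))
  intro f hf
  rw [← sum_homogeneousComponent f]
  exact Ideal.sum_mem _ fun k _ => key k _ (hPhom f hf k) (homogeneousComponent_isHomogeneous k f)

/-- If the coefficients at the exponents `U j` vanish on all multiples `X i * f` with `f ∈ P`, and
take independent values on `P`, then `P` needs as many generators as there are exponents. -/
lemma card_le_spanFinrank {P : Ideal (MvPolynomial σ K)} (hP : P.FG) {ι : Type*} [Fintype ι]
    [DecidableEq ι] (U : ι → σ →₀ ℕ) (g : ι → MvPolynomial σ K) (hg : ∀ j, g j ∈ P)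
    (hcoeff : ∀ j j', coeff (U j') (g j) = if j = j' then 1 else 0)
    (hvan : ∀ f ∈ P, ∀ i j, coeff (U j) (X i * f) = 0) :
    Fintype.card ι ≤ P.spanFinrank := by
  classical
  obtain ⟨S, hcard, hS⟩ := Submodule.FG.exists_span_finset_card_eq_spanFinrank hP
  let Φ : MvPolynomial σ K →ₗ[K] ι → K := LinearMap.pi fun j => lcoeff K (U j)
  have hΦ : ∀ f j, Φ f j = coeff (U j) f := fun f j => rfl
  have hW : ∀ f ∈ P, f ∈ P ∧ Φ f ∈ Submodule.span K ((S.image Φ : Finset (ι → K)) :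
      Set (ι → K)) := by
    intro f hf
    rw [← hS] at hf
    induction hf using Submodule.span_induction with
    | mem x hx =>
      refine ⟨hS ▸ Submodule.subset_span hx, Submodule.subset_span ?_⟩
      rw [Finset.coe_image]
      exact Set.mem_image_of_mem _ hx
    | zero => exact ⟨zero_mem _, by rw [map_zero]; exact zero_mem _⟩
    | add x y _ _ hx hy => exact ⟨add_mem hx.1 hy.1, by rw [map_add]; exact add_mem hx.2 hy.2⟩
    | smul c x _ hx =>
      refine ⟨Ideal.mul_mem_left _ c hx.1, ?_⟩
      rw [smul_eq_mul]
      induction c using induction_on with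
      | C a =>
        rw [C_mul', map_smul]
        exact Submodule.smul_mem _ _ hx.2
      | add p q hp hq =>
        rw [add_mul, map_add]
        exact add_mem hp hq
      -- Multipliers without constant term contribute nothing, so the image of `P` is spanned over
      -- `K` by the images of the generators.
      | mul_X p i _ =>
        have : Φ (p * X i * x) = 0 := by
          ext j
          rw [hΦ, mul_comm p, mul_assoc]
          exact hvan _ (Ideal.mul_mem_left _ p hx.1) i j
        rw [this]
        exact zero_mem _
  have htop : Submodule.span K ((S.image Φ : Finset (ι → K)) : Set (ι → K)) = ⊤ := by
    rw [eq_top_iff, ← (Pi.basisFun K ι).span_eq, Submodule.span_le]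
    rintro _ ⟨j, rfl⟩
    have : Pi.basisFun K ι j = Φ (g j) := by
      ext j'
      rw [hΦ, hcoeff, Pi.basisFun_apply, Pi.single_apply]
      simp only [eq_comm]
    rw [this]
    exact (hW _ (hg j)).2
  have h := finrank_span_finset_le_card (R := K) (S.image Φ)
  rw [Set.finrank, htop, finrank_top, Module.finrank_fintype_fun_eq_card] at h
  rw [← hcard]
  exact h.trans Finset.card_image_le

end MvPolynomial

/-! ### Toric ideal, order ideal, and lifts of monomials -/

namespace MonomialCurve
open MvPolynomial

variable {K : Type*} [Field K] {r : ℕ} {n : Fin r → ℕ}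

lemma coeff_aeval_eq_sumOn (f : MvPolynomial (Fin r) K) (s : ℕ) :
    (aeval (fun i => (Polynomial.X : Polynomial K) ^ n i) f).coeff s =
      sumOn (fun u => wt n u = s) f := by
  induction f using MvPolynomial.induction_on' with
  | monomial u c =>
    have h : ∏ i, ((Polynomial.X : Polynomial K) ^ n i) ^ u i = Polynomial.X ^ wt n u := by
      rw [wt, ← Finset.prod_pow_eq_pow_sum]
      exact Finset.prod_congr rfl fun i _ => by rw [← pow_mul, mul_comm]
    rw [sumOn_monomial, aeval_monomial, Finsupp.prod_fintype _ _ (by simp), h,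
      Polynomial.algebraMap_apply, Algebra.algebraMap_self, RingHom.id_apply,
      Polynomial.coeff_C_mul_X_pow]
    simp only [eq_comm]
  | add f g hf hg => rw [map_add, Polynomial.coeff_add, hf, hg, map_add]

lemma mem_toricIdeal_iff {f : MvPolynomial (Fin r) K} :
    f ∈ toricIdeal K n ↔ ∀ s, sumOn (fun u => wt n u = s) f = 0 := by
  rw [toricIdeal, RingHom.mem_ker, Polynomial.ext_iff]
  exact forall_congr' fun s => by
    rw [← coeff_aeval_eq_sumOn, Polynomial.coeff_zero]

lemma monomial_sub_mem_toricIdeal {u v : Fin r →₀ ℕ} (h : wt n u = wt n v) :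
    monomial u (1 : K) - monomial v 1 ∈ toricIdeal K n := by
  rw [mem_toricIdeal_iff]
  intro s
  rw [map_sub, sumOn_monomial, sumOn_monomial, h, sub_self]

lemma leastForm_eq {f g : MvPolynomial (Fin r) K} {k : ℕ} (hg : g ≠ 0)
    (hk : homogeneousComponent k f = g) (hlt : ∀ j < k, homogeneousComponent j f = 0) :
    leastForm f = g := by
  have : sInf {k : ℕ | homogeneousComponent k f ≠ 0} = k := by
    refine le_antisymm (Nat.sInf_le (by simpa [hk] using hg)) (le_csInf ⟨k, by simpa [hk]⟩ ?_)
    intro j hj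
    by_contra h
    exact hj (hlt j (by omega))
  rw [leastForm, this, hk]

lemma homogeneousComponent_monomial (u : Fin r →₀ ℕ) (k : ℕ) :
    homogeneousComponent k (monomial u (1 : K)) = if k = u.degree then monomial u 1 else 0 :=
  homogeneousComponent_of_mem (isHomogeneous_monomial _ rfl)

lemma monomial_mem_tangentConeIdeal {u v : Fin r →₀ ℕ} (h : wt n u = wt n v)
    (hd : u.degree < v.degree) : monomial u (1 : K) ∈ tangentConeIdeal (toricIdeal K n) := by
  refine Ideal.subset_span ⟨_, monomial_sub_mem_toricIdeal h, (leastForm_eq (k := u.degree)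
    (by simp) ?_ ?_).symm⟩
  · rw [map_sub, homogeneousComponent_monomial, homogeneousComponent_monomial, if_pos rfl,
      if_neg hd.ne, sub_zero]
  · intro j hj
    rw [map_sub, homogeneousComponent_monomial, homogeneousComponent_monomial, if_neg hj.ne,
      if_neg (hj.trans hd).ne, sub_zero]

lemma monomial_sub_mem_tangentConeIdeal {u v : Fin r →₀ ℕ} (h : wt n u = wt n v)
    (hd : u.degree = v.degree) :
    monomial u (1 : K) - monomial v 1 ∈ tangentConeIdeal (toricIdeal K n) := by
  by_cases h0 : monomial u (1 : K) - monomial v 1 = 0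
  · rw [h0]; exact zero_mem _
  refine Ideal.subset_span ⟨_, monomial_sub_mem_toricIdeal h, (leastForm_eq (k := u.degree)
    h0 ?_ ?_).symm⟩
  · rw [map_sub, homogeneousComponent_monomial, homogeneousComponent_monomial, if_pos rfl,
      if_pos hd]
  · intro j hj
    rw [map_sub, homogeneousComponent_monomial, homogeneousComponent_monomial, if_neg hj.ne,
      if_neg (hd ▸ hj.ne), sub_zero]

/-- The ideal of the polynomials that vanish in the associated graded ring of the semigroup
algebra: for every weight `s` that is attained in degree `k` at most, the sum of the coefficients
at the exponents of weight `s` and degree `k` vanishes. -/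
def orderIdeal (K : Type*) [Field K] (n : Fin r → ℕ) : Ideal (MvPolynomial (Fin r) K) where
  carrier := {f | ∀ s k, (∀ v, wt n v = s → v.degree ≤ k) →
    sumOn (fun u => wt n u = s ∧ u.degree = k) f = 0}
  add_mem' := fun hf hg s k h => by rw [map_add, hf s k h, hg s k h, add_zero]
  zero_mem' := fun s k _ => map_zero _
  smul_mem' := by
    intro c f hf s k h
    induction c using MvPolynomial.induction_on' with
    | monomial w a =>
      rw [smul_eq_mul, ← mul_one a, ← smul_eq_mul a, ← smul_monomial, smul_mul_assoc, map_smul,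
        sumOn_monomial_mul]
      -- If some `w + u₀` is of top degree in its fibre, so is `u₀` in its own, and the sum over the
      -- shifted fibre is one already known to vanish. Otherwise the sum is empty.
      by_cases hex : ∃ u₀, wt n (w + u₀) = s ∧ (w + u₀).degree = k
      · obtain ⟨u₀, hu, hu'⟩ := hex
        rw [wt_add] at hu
        rw [map_add] at hu'
        have h1 := hf (wt n u₀) u₀.degree fun v hv => by
          have := h (w + v) (by rw [wt_add, hv, hu])
          rw [map_add] at this
          omega
        rw [sumOn_congr (q := fun u => wt n u = wt n u₀ ∧ u.degree = u₀.degree), h1, smul_zero]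
        intro u _
        rw [wt_add, map_add]
        omega
      · rw [sumOn_eq_zero fun u hu => absurd ⟨u, hu⟩ hex, smul_zero]
    | add c e hc he => rw [add_smul, map_add, hc, he, add_zero]

/-- For `f` in the toric ideal the coefficients over a whole weight fibre sum to zero. When `k` is
the least degree of `f`, the support has degrees at least `k` and the fibre has degrees at most `k`,
so only degree `k` contributes. -/
lemma tangentConeIdeal_le_orderIdeal :
    tangentConeIdeal (toricIdeal K n) ≤ orderIdeal K n := by
  refine Ideal.span_le.mpr ?_
  rintro _ ⟨f, hf, rfl⟩
  intro s k hk
  rw [mem_toricIdeal_iff] at hf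
  rw [leastForm]
  set k₀ := sInf {k : ℕ | homogeneousComponent k f ≠ 0} with hk₀
  by_cases h : k = k₀
  · subst h
    rw [← hf s, sumOn_congr_coeff (g := f)]
    · refine sumOn_congr fun u hu => ⟨fun h => h.1, fun h => ⟨h, le_antisymm (hk u h) ?_⟩⟩
      refine Nat.sInf_le ?_
      intro h0
      apply hu
      have := congrArg (coeff u) h0
      rwa [coeff_homogeneousComponent, if_pos rfl] at this
    · rintro u ⟨-, hu⟩
      rw [coeff_homogeneousComponent, if_pos hu]
  · refine sumOn_eq_zero fun u hu => ?_
    rw [coeff_homogeneousComponent, if_neg (by omega)]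

lemma homogeneousComponent_mem_orderIdeal {f : MvPolynomial (Fin r) K} (hf : f ∈ orderIdeal K n)
    (j : ℕ) : homogeneousComponent j f ∈ orderIdeal K n := by
  intro s k hk
  by_cases h : k = j
  · rw [← hf s k hk]
    refine sumOn_congr_coeff fun u hu => ?_
    rw [coeff_homogeneousComponent, if_pos (by omega)]
  · refine sumOn_eq_zero fun u hu => ?_
    rw [coeff_homogeneousComponent, if_neg (by omega)]

/-- Adding the `i₀`-th generator to an element of the semigroup raises its order by one only. -/
def IsOrderCompatible (n : Fin r → ℕ) (i₀ : Fin r) : Prop :=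
  ∀ u v, wt n v = wt n u + n i₀ → ∃ u', wt n u' = wt n u ∧ v.degree ≤ u'.degree + 1

variable {i₀ : Fin r}

/-- Multiplication by `X i₀` moves the fibre of weight `s` and degree `k` to weight `s + n i₀` and
degree `k + 1`; compatibility ensures that top degrees stay top. -/
lemma IsOrderCompatible.mem_of_X_mul_mem (hn : IsOrderCompatible n i₀)
    {f : MvPolynomial (Fin r) K} (hf : X i₀ * f ∈ orderIdeal K n) : f ∈ orderIdeal K n := by
  intro s k hk
  by_cases hex : ∃ u₀, wt n u₀ = s
  · obtain ⟨u₀, rfl⟩ := hex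
    have h := hf (wt n u₀ + n i₀) (k + 1) fun v hv => by
      obtain ⟨u', hu', h⟩ := hn u₀ v hv
      have := hk u' hu'
      omega
    rw [sumOn_X_mul] at h
    rw [← h]
    refine sumOn_congr fun u _ => ?_
    rw [wt_add, wt_single, map_add, Finsupp.degree_single]
    omega
  · exact sumOn_eq_zero fun u hu => absurd ⟨u, hu.1⟩ hex

/-- `g` is a homogeneous element of the tangent cone ideal that agrees with `x ^ u` modulo the
variable `x_i`. -/
structure IsLift (n : Fin r → ℕ) (i₀ : Fin r) (u : Fin r →₀ ℕ) (g : MvPolynomial (Fin r) K) :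
    Prop where
  mem : g ∈ tangentConeIdeal (toricIdeal K n)
  hom : g.IsHomogeneous u.degree
  eq : ∃ q, g = monomial u 1 - X i₀ * q

lemma exists_isLift_of_degree_lt (K : Type*) [Field K] (i₀ : Fin r) {u v : Fin r →₀ ℕ}
    (h : wt n u = wt n v) (hd : u.degree < v.degree) :
    ∃ g : MvPolynomial (Fin r) K, IsLift n i₀ u g :=
  ⟨monomial u 1, monomial_mem_tangentConeIdeal h hd, isHomogeneous_monomial _ rfl, 0, by simp⟩

/-- Compatibility replaces `v` by a vector of the same weight that still contains `x_{i₀}` and has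
degree at least that of `u`. If the degree is larger, `x ^ u` itself is a least form; if equal, the
homogeneous binomial is the lift. -/
lemma IsOrderCompatible.exists_isLift (hn : IsOrderCompatible n i₀) (K : Type*) [Field K]
    {u v : Fin r →₀ ℕ} (h : wt n u = wt n v) (hv : 0 < v i₀) :
    ∃ g : MvPolynomial (Fin r) K, IsLift n i₀ u g := by
  have hv' : Finsupp.single i₀ 1 + (v - Finsupp.single i₀ 1) = v :=
    add_tsub_cancel_of_le (Finsupp.single_le_iff.mpr hv)
  have hw : wt n u = wt n (v - Finsupp.single i₀ 1) + n i₀ := by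
    rw [h]
    conv_lhs => rw [← hv', wt_add, wt_single, one_mul, add_comm]
  obtain ⟨u', hu', hd⟩ := hn _ u hw
  have hwt : wt n u = wt n (Finsupp.single i₀ 1 + u') := by
    rw [wt_add, wt_single, hu', hw]; ring
  have hdeg : (Finsupp.single i₀ 1 + u').degree = u'.degree + 1 := by
    rw [map_add, Finsupp.degree_single, add_comm]
  rcases hd.lt_or_eq with hd | hd
  · exact exists_isLift_of_degree_lt K i₀ hwt (by omega)
  · refine ⟨monomial u 1 - monomial (Finsupp.single i₀ 1 + u') 1,
      monomial_sub_mem_tangentConeIdeal hwt (by omega),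
      (isHomogeneous_monomial _ rfl).sub (isHomogeneous_monomial _ (by omega)),
      monomial u' 1, ?_⟩
    rw [X, monomial_mul, one_mul]

lemma IsLift.coeff_eq {u v : Fin r →₀ ℕ} {g : MvPolynomial (Fin r) K} (hg : IsLift n i₀ u g)
    [Decidable (u = v)] (hv : v i₀ = 0) : coeff v g = if u = v then 1 else 0 := by
  classical
  obtain ⟨q, hq⟩ := hg.eq
  rw [hq, coeff_sub, coeff_monomial, coeff_X_mul', if_neg (c := i₀ ∈ v.support) (by simp [hv]),
    sub_zero]
  congr

lemma IsLift.monomial_mem {u v : Fin r →₀ ℕ} {g : MvPolynomial (Fin r) K} (hg : IsLift n i₀ u g)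
    {J : Ideal (MvPolynomial (Fin r) K)} (hgJ : g ∈ J) (hX : X i₀ ∈ J) (huv : u ≤ v) (c : K) :
    monomial v c ∈ J := by
  obtain ⟨q, hq⟩ := hg.eq
  have h : monomial v c = monomial (v - u) c * (g + X i₀ * q) := by
    rw [hq, sub_add_cancel, monomial_mul, mul_one, tsub_add_cancel_of_le huv]
  rw [h]
  exact Ideal.mul_mem_left _ _ (add_mem hgJ (Ideal.mul_mem_right _ _ hX))

/-- The coefficient at `w` vanishes on the order ideal if `w` is the only exponent of its weight
and degree, and the exponents of its weight have at most its degree. -/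
lemma coeff_eq_zero_of_mem_orderIdeal {f : MvPolynomial (Fin r) K} (hf : f ∈ orderIdeal K n)
    {w : Fin r →₀ ℕ} (hw : ∀ v, wt n v = wt n w → v ≠ w → v.degree < w.degree) :
    coeff w f = 0 := by
  rw [← hf (wt n w) w.degree, sumOn_eq_coeff ⟨rfl, rfl⟩]
  · intro v hv hne
    exact absurd hv.2 (hw v hv.1 hne).ne
  · intro v hv
    by_cases h : v = w
    · rw [h]
    · exact (hw v hv h).le

end MonomialCurve

/-! ### Counting generators; exponent vectors in four variables -/

namespace MonomialCurve
open MvPolynomial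

section

variable {K : Type*} [Field K] {r : ℕ} {n : Fin r → ℕ} {i₀ : Fin r}

/-- Upper bound: `hle` and graded Nakayama make the `g j` generate the order ideal, which is
squeezed onto the tangent cone ideal. Lower bound: `hcoeff` and `hvan` say that the coefficients at
the `U j` are coordinates modulo the irrelevant ideal times it. -/
lemma IsOrderCompatible.spanFinrank_tangentConeIdeal (hn : IsOrderCompatible n i₀) {ι : Type*}
    [Fintype ι] [DecidableEq ι] (U : ι → Fin r →₀ ℕ) (g : ι → MvPolynomial (Fin r) K)
    (hg : ∀ j, g j ∈ tangentConeIdeal (toricIdeal K n)) (hhom : ∀ j, ∃ k, (g j).IsHomogeneous k)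
    (hcoeff : ∀ j j', coeff (U j') (g j) = if j = j' then 1 else 0)
    (hvan : ∀ f ∈ orderIdeal K n, ∀ i j, coeff (U j) (X i * f) = 0)
    (hle : orderIdeal K n ≤ Ideal.span (Set.range g) ⊔ Ideal.span {X i₀}) :
    (tangentConeIdeal (toricIdeal K n)).spanFinrank = Fintype.card ι := by
  have hgT : Ideal.span (Set.range g) ≤ tangentConeIdeal (toricIdeal K n) :=
    Ideal.span_le.mpr (Set.range_subset_iff.mpr hg)
  have h1 : orderIdeal K n ≤ Ideal.span (Set.range g) := by
    refine le_span_of_le_sup_span_X ?_ ?_ (fun f hf => homogeneousComponent_mem_orderIdeal hf)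
      (fun f => hn.mem_of_X_mul_mem) hle
    · rintro _ ⟨j, rfl⟩
      exact hhom j
    · exact Set.range_subset_iff.mpr fun j => tangentConeIdeal_le_orderIdeal (hg j)
  have h2 : tangentConeIdeal (toricIdeal K n) = Ideal.span (Set.range g) :=
    le_antisymm (tangentConeIdeal_le_orderIdeal.trans h1) hgT
  refine le_antisymm ?_ ?_
  · rw [h2]
    refine (Submodule.spanFinrank_span_le_ncard_of_finite (Set.finite_range g)).trans ?_
    rw [← Set.image_univ, ← Nat.card_eq_fintype_card, ← Set.ncard_univ]
    exact Set.ncard_image_le Set.finite_univ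
  · exact card_le_spanFinrank (IsNoetherian.noetherian _) U g hg hcoeff
      fun f hf => hvan f (tangentConeIdeal_le_orderIdeal hf)

lemma wt_eq_of_monomial_sub_mem {u v : Fin r →₀ ℕ}
    (h : monomial u (1 : K) - monomial v 1 ∈ toricIdeal K n) : wt n u = wt n v := by
  have := mem_toricIdeal_iff.mp h (wt n u)
  rw [map_sub, sumOn_monomial, sumOn_monomial, if_pos rfl] at this
  by_contra h'
  rw [if_neg (fun h => h' h.symm), sub_zero] at this
  exact one_ne_zero this

lemma sumOn_monomial_mul_monomial_sub {p : (Fin r →₀ ℕ) → Prop} {m u v : Fin r →₀ ℕ}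
    (h : p (m + u) ↔ p (m + v)) :
    sumOn p (monomial m 1 * (monomial u (1 : K) - monomial v 1)) = 0 := by
  rw [mul_sub, monomial_mul, monomial_mul, map_sub, sumOn_monomial, sumOn_monomial]
  by_cases hv : p (m + v)
  · rw [if_pos (h.mpr hv), if_pos hv, sub_self]
  · rw [if_neg (mt h.mp hv), if_neg hv, sub_self]

lemma sumOn_eq_zero_of_mem_span {p : (Fin r →₀ ℕ) → Prop} {S : Set (MvPolynomial (Fin r) K)}
    (h : ∀ g ∈ S, ∀ m, sumOn p (monomial m 1 * g) = 0) {f : MvPolynomial (Fin r) K}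
    (hf : f ∈ Ideal.span S) : sumOn p f = 0 := by
  have key : ∀ m, sumOn p (monomial m 1 * f) = 0 := by
    induction hf using Submodule.span_induction with
    | mem g hg => exact h g hg
    | zero => simp
    | add x y _ _ hx hy => intro m; rw [mul_add, map_add, hx, hy, add_zero]
    | smul c x _ hx =>
      intro m
      rw [smul_eq_mul]
      induction c using MvPolynomial.induction_on' with
      | monomial w b =>
        have : monomial m (1 : K) * (monomial w b * x) = b • (monomial (m + w) 1 * x) := by
          rw [← mul_assoc, monomial_mul, one_mul, ← smul_mul_assoc, smul_monomial, smul_eq_mul,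
            mul_one]
        rw [this, map_smul, hx, smul_zero]
      | add c e hc he => rw [add_mul, mul_add, map_add, hc, he, add_zero]
  have h1 : (monomial 0 (1 : K) : MvPolynomial (Fin r) K) = 1 := rfl
  rw [← one_mul f, ← h1]
  exact key 0

end

/-- The exponent vector `(m, i, j, k)`. -/
def expo (m i j k : ℕ) : Fin 4 →₀ ℕ := Finsupp.equivFunOnFinite.symm ![m, i, j, k]

section expo

variable (m i j k : ℕ)

@[simp] lemma expo_zero : expo m i j k 0 = m := rfl
@[simp] lemma expo_one : expo m i j k 1 = i := rfl
@[simp] lemma expo_two : expo m i j k 2 = j := rfl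
@[simp] lemma expo_three : expo m i j k 3 = k := rfl

lemma exponent_ext {u v : Fin 4 →₀ ℕ} (h0 : u 0 = v 0) (h1 : u 1 = v 1) (h2 : u 2 = v 2)
    (h3 : u 3 = v 3) : u = v := by
  ext t
  fin_cases t <;> assumption

lemma exponent_le {u v : Fin 4 →₀ ℕ} (h0 : u 0 ≤ v 0) (h1 : u 1 ≤ v 1) (h2 : u 2 ≤ v 2)
    (h3 : u 3 ≤ v 3) : u ≤ v := by
  intro t
  fin_cases t <;> assumption

lemma wt_four (n : Fin 4 → ℕ) (u : Fin 4 →₀ ℕ) :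
    wt n u = u 0 * n 0 + u 1 * n 1 + u 2 * n 2 + u 3 * n 3 := Fin.sum_univ_four _

lemma degree_four (u : Fin 4 →₀ ℕ) : u.degree = u 0 + u 1 + u 2 + u 3 := by
  rw [Finsupp.degree_eq_sum, Fin.sum_univ_four]

lemma X_pow_eq_monomial_expo (K : Type*) [Field K] :
    (X 0 : MvPolynomial (Fin 4) K) ^ m = monomial (expo m 0 0 0) 1 ∧
    (X 1 : MvPolynomial (Fin 4) K) ^ i = monomial (expo 0 i 0 0) 1 ∧
    (X 2 : MvPolynomial (Fin 4) K) ^ j = monomial (expo 0 0 j 0) 1 ∧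
    (X 3 : MvPolynomial (Fin 4) K) ^ k = monomial (expo 0 0 0 k) 1 := by
  simp only [X_pow_eq_monomial]
  refine ⟨?_, ?_, ?_, ?_⟩ <;> congr 2 <;> apply exponent_ext <;> simp

lemma expo_add (m' i' j' k' : ℕ) :
    expo m i j k + expo m' i' j' k' = expo (m + m') (i + i') (j + j') (k + k') := by
  apply exponent_ext <;> simp

lemma coeff_expo_X_mul {K : Type*} [Field K] {f : MvPolynomial (Fin 4) K} {i j k : ℕ}
    (hi : 0 < i → coeff (expo 0 (i - 1) j k) f = 0)
    (hj : 0 < j → coeff (expo 0 i (j - 1) k) f = 0)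
    (hk : 0 < k → coeff (expo 0 i j (k - 1)) f = 0) (t : Fin 4) :
    coeff (expo 0 i j k) (X t * f) = 0 := by
  rw [coeff_X_mul']
  split_ifs with h
  swap
  · rfl
  rw [Finsupp.mem_support_iff] at h
  have h' := Nat.pos_of_ne_zero h
  fin_cases t
  · exact absurd rfl h
  · rw [← hi h']; congr 1; apply exponent_ext <;> simp
  · rw [← hj h']; congr 1; apply exponent_ext <;> simp
  · rw [← hk h']; congr 1; apply exponent_ext <;> simp

end expo

/-! ### Normal forms modulo x_1 and the fibres of the weight -/

namespace Exponents

variable (a : Exponents)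

lemma binomials_eq (K : Type*) [Field K] : a.binomials K =
    ![monomial (expo 0 0 a.a13 a.a14) 1 - monomial (expo a.a1 0 0 0) 1,
      monomial (expo 0 a.a2 0 0) 1 - monomial (expo a.a21 0 a.a23 0) 1,
      monomial (expo 0 0 a.a3 0) 1 - monomial (expo 0 a.a32 0 a.a34) 1,
      monomial (expo 0 0 0 a.a4) 1 - monomial (expo a.a41 a.a42 0 0) 1,
      monomial (expo 0 a.a42 a.a13 0) 1 - monomial (expo a.a21 0 0 a.a34) 1] := by
  have h0 := fun m => (X_pow_eq_monomial_expo m 0 0 0 K).1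
  have h1 := fun m => (X_pow_eq_monomial_expo 0 m 0 0 K).2.1
  have h2 := fun m => (X_pow_eq_monomial_expo 0 0 m 0 K).2.2.1
  have h3 := fun m => (X_pow_eq_monomial_expo 0 0 0 m K).2.2.2
  simp only [binomials, h0, h1, h2, h3, monomial_mul, expo_add, mul_one, add_zero, zero_add]

/-- `x_2 ^ i x_3 ^ j x_4 ^ k` is a normal form modulo the binomials and `x_1`. -/
structure IsStd (i j k : ℕ) : Prop where
  j_lt : j < a.a3
  i_lt : i < a.a2
  k_lt : k < a.a4
  jk : ¬ (a.a13 ≤ j ∧ a.a14 ≤ k)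
  ij : ¬ (a.a13 ≤ j ∧ a.a42 ≤ i)

/-- `x ^ u` has the normal form `x_2 ^ i x_3 ^ j x_4 ^ k`, reached by `l` replacements of
`x_3 ^ a_3`. -/
structure Red (i j k : ℕ) (u : Fin 4 →₀ ℕ) (l : ℕ) : Prop where
  h0 : u 0 = 0
  h1 : u 1 + a.a32 * l = i
  h2 : u 2 = j + a.a3 * l
  h3 : u 3 + a.a34 * l = k

variable {a} {K : Type*} [Field K] {n : Fin 4 → ℕ}

/-- The class of a normal form is stable under the binomial moves. For f_3 the two terms lie in the
class together, with `l` shifted by one. For the other four neither does: one term contains `x_1`,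
the other would violate a bound in `IsStd`. -/
lemma IsStd.sumOn_eq_zero {i j k : ℕ} (hw : a.IsStd i j k)
    {f : MvPolynomial (Fin 4) K} (hf : f ∈ Ideal.span (Set.range (a.binomials K))) :
    sumOn (fun u => ∃ l, a.Red i j k u l) f = 0 := by
  refine sumOn_eq_zero_of_mem_span ?_ hf
  rw [binomials_eq]
  obtain ⟨w2, w1, w3, w4, w5⟩ := hw
  have p21 := a.a21_pos
  have p41 := a.a41_pos
  unfold Exponents.a3 at w2
  unfold Exponents.a2 at w1
  unfold Exponents.a4 at w3
  rintro _ ⟨t, rfl⟩ m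
  fin_cases t <;> refine sumOn_monomial_mul_monomial_sub ?_
  · refine iff_of_false ?_ ?_
    · rintro ⟨l, h0, h1, h2, h3⟩
      simp at h0 h1 h2 h3
      -- Without a replacement this contradicts `jk`; with at least one, the `x_4`-exponent of the
      -- normal form reaches `a_14 + a_34 = a_4`. The case of f_5 is alike, with `ij` and `a_2`.
      rcases l with _ | l
      · simp at h2 h3; omega
      · rw [Nat.mul_succ] at h3; omega
    · rintro ⟨l, h0, -⟩
      simp [Exponents.a1] at h0; omega
  · refine iff_of_false ?_ ?_
    · rintro ⟨l, h0, h1, h2, h3⟩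
      simp [Exponents.a2] at h1; omega
    · rintro ⟨l, h0, -⟩
      simp at h0; omega
  · constructor
    · rintro ⟨l, h0, h1, h2, h3⟩
      simp at h0 h1 h2 h3
      rcases l with _ | l
      · simp [Exponents.a3] at h2; omega
      · rw [Nat.mul_succ] at h1 h2 h3
        refine ⟨l, ?_, ?_, ?_, ?_⟩ <;> simp <;> omega
    · rintro ⟨l, h0, h1, h2, h3⟩
      simp at h0 h1 h2 h3
      refine ⟨l + 1, ?_, ?_, ?_, ?_⟩ <;> simp [Nat.mul_succ] <;> omega
  · refine iff_of_false ?_ ?_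
    · rintro ⟨l, h0, h1, h2, h3⟩
      simp [Exponents.a4] at h3; omega
    · rintro ⟨l, h0, -⟩
      simp at h0; omega
  · refine iff_of_false ?_ ?_
    · rintro ⟨l, h0, h1, h2, h3⟩
      simp at h0 h1 h2 h3
      rcases l with _ | l
      · simp at h2 h1; omega
      · rw [Nat.mul_succ] at h1; omega
    · rintro ⟨l, h0, -⟩
      simp at h0; omega

/-- The difference of the two monomials lies in I(C), so the sum over the class vanishes on it; both
or neither belong. Thus the class is a whole weight fibre. -/
lemma IsStd.red_of_wt_eq {i j k : ℕ} (hw : a.IsStd i j k)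
    (ha : Ideal.span (Set.range (a.binomials K)) = toricIdeal K n) {u v : Fin 4 →₀ ℕ}
    (huv : wt n v = wt n u) {l : ℕ} (hu : a.Red i j k u l) : ∃ l', a.Red i j k v l' := by
  have h := monomial_sub_mem_toricIdeal (K := K) huv.symm
  rw [← ha] at h
  have := hw.sumOn_eq_zero h
  rw [map_sub, sumOn_monomial, sumOn_monomial, if_pos ⟨l, hu⟩] at this
  by_contra h'
  rw [if_neg h'] at this
  simp at this

lemma Red.eq {i j k l : ℕ} {u v : Fin 4 →₀ ℕ} (hu : a.Red i j k u l) (hv : a.Red i j k v l) :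
    v = u := by
  obtain ⟨h0, h1, h2, h3⟩ := hu
  obtain ⟨h0', h1', h2', h3'⟩ := hv
  apply exponent_ext <;> omega

/-- Here `(i, j, k)` is the `l`-th vector of its chain, and `hik` says that no further trade is
possible. By `hl` it is either the only vector of the chain or the degrees strictly increase along
it, so it is the unique vector of top degree. -/
lemma IsStd.coeff_eq_zero_of_lt {i j k j' l : ℕ} (hw : a.IsStd (i + a.a32 * l) j' (k + a.a34 * l))
    (ha : Ideal.span (Set.range (a.binomials K)) = toricIdeal K n)
    (hj : j = j' + a.a3 * l) (hik : i < a.a32 ∨ k < a.a34) (hl : l = 0 ∨ a.a32 + a.a34 < a.a3)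
    {f : MvPolynomial (Fin 4) K} (hf : f ∈ orderIdeal K n) : coeff (expo 0 i j k) f = 0 := by
  have hu : a.Red (i + a.a32 * l) j' (k + a.a34 * l) (expo 0 i j k) l := ⟨rfl, rfl, hj, rfl⟩
  refine coeff_eq_zero_of_mem_orderIdeal hf fun v hv hne => ?_
  obtain ⟨l', hv'⟩ := hw.red_of_wt_eq ha hv hu
  rcases lt_trichotomy l' l with h | h | h
  · obtain ⟨s, rfl⟩ := Nat.exists_eq_add_of_lt h
    have h4 := Nat.mul_lt_mul_of_pos_right (hl.resolve_left (by omega)) (Nat.succ_pos s)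
    have h1 := hv'.h1
    have h2 := hv'.h2
    have h3 := hv'.h3
    have h0 := hv'.h0
    rw [degree_four, degree_four]
    simp only [expo_zero, expo_one, expo_two, expo_three, Nat.succ_eq_add_one] at *
    rw [add_assoc l' s 1, mul_add _ l'] at h1 h3 hj
    rw [add_mul] at h4
    omega
  · subst h
    exact absurd (hu.eq hv') hne
  · exfalso
    obtain ⟨s, rfl⟩ := Nat.exists_eq_add_of_lt h
    have h1 := hv'.h1
    have h3 := hv'.h3
    rw [mul_add, mul_add] at h1 h3
    omega

/-- Degrees now strictly decrease along the chain, so its start, the normal form, is alone on top.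
-/
lemma IsStd.coeff_eq_zero_of_degree_lt {i j k : ℕ} (hw : a.IsStd i j k)
    (ha : Ideal.span (Set.range (a.binomials K)) = toricIdeal K n)
    (hlt : a.a3 < a.a32 + a.a34)
    {f : MvPolynomial (Fin 4) K} (hf : f ∈ orderIdeal K n) : coeff (expo 0 i j k) f = 0 := by
  have hu : a.Red i j k (expo 0 i j k) 0 := ⟨rfl, rfl, rfl, rfl⟩
  refine coeff_eq_zero_of_mem_orderIdeal hf fun v hv hne => ?_
  obtain ⟨l', hv'⟩ := hw.red_of_wt_eq ha hv hu
  rcases Nat.eq_zero_or_pos l' with h | h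
  · subst h
    exact absurd (hu.eq hv') hne
  · have h4 := Nat.mul_lt_mul_of_pos_right hlt h
    have h1 := hv'.h1
    have h2 := hv'.h2
    have h3 := hv'.h3
    have h0 := hv'.h0
    rw [degree_four, degree_four]
    simp only [expo_zero, expo_one, expo_two, expo_three] at *
    rw [add_mul] at h4
    omega

end Exponents
end MonomialCurve

/-! ### The case a_3 ≤ a_32 + a_34 -/

namespace MonomialCurve
open MvPolynomial
namespace Exponents

variable {a : Exponents} {K : Type*} [Field K] {n : Fin 4 → ℕ}

/-- The weights of the two terms of each binomial agree. -/
structure IsBalanced (a : Exponents) (n : Fin 4 → ℕ) : Prop where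
  w1 : a.a13 * n 2 + a.a14 * n 3 = a.a1 * n 0
  w2 : a.a2 * n 1 = a.a21 * n 0 + a.a23 * n 2
  w3 : a.a3 * n 2 = a.a32 * n 1 + a.a34 * n 3
  w4 : a.a4 * n 3 = a.a41 * n 0 + a.a42 * n 1
  w5 : a.a42 * n 1 + a.a13 * n 2 = a.a21 * n 0 + a.a34 * n 3

lemma isBalanced (ha : Ideal.span (Set.range (a.binomials K)) = toricIdeal K n) :
    a.IsBalanced n := by
  have h : ∀ t, a.binomials K t ∈ toricIdeal K n := fun t =>
    ha ▸ Ideal.subset_span (Set.mem_range_self t)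
  rw [binomials_eq] at h
  have h0 := wt_eq_of_monomial_sub_mem (h 0)
  have h1 := wt_eq_of_monomial_sub_mem (h 1)
  have h2 := wt_eq_of_monomial_sub_mem (h 2)
  have h3 := wt_eq_of_monomial_sub_mem (h 3)
  have h4 := wt_eq_of_monomial_sub_mem (h 4)
  simp [wt_four] at h0 h1 h2 h3 h4
  exact ⟨h0, h1, h2, h3, h4⟩

lemma monomial_mem_of_pos {J : Ideal (MvPolynomial (Fin 4) K)} (hX : X 0 ∈ J)
    {u : Fin 4 →₀ ℕ} (h0 : 0 < u 0) (c : K) : monomial u c ∈ J := by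
  have h1 : monomial u c = monomial (u - Finsupp.single 0 1) c * X 0 := by
    rw [X, monomial_mul, mul_one, tsub_add_cancel_of_le (Finsupp.single_le_iff.mpr h0)]
  rw [h1]
  exact Ideal.mul_mem_left _ _ hX

lemma mem_of_forall_coeff {f : MvPolynomial (Fin 4) K} {J : Ideal (MvPolynomial (Fin 4) K)}
    (hX : X 0 ∈ J) (h : ∀ i j k, coeff (expo 0 i j k) f ≠ 0 → monomial (expo 0 i j k) 1 ∈ J) :
    f ∈ J := by
  rw [f.as_sum]
  refine Ideal.sum_mem _ fun u hu => ?_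
  rcases Nat.eq_zero_or_pos (u 0) with h0 | h0
  · have hu' : u = expo 0 (u 1) (u 2) (u 3) := exponent_ext h0 rfl rfl rfl
    have := h (u 1) (u 2) (u 3) (hu' ▸ mem_support_iff.mp hu)
    rw [← hu'] at this
    rw [← mul_one (coeff u f), ← C_mul_monomial]
    exact Ideal.mul_mem_left _ _ this
  · exact monomial_mem_of_pos hX h0 _

/-- The exponents of the leading terms of the binomials modulo `x_1`. -/
def leading (a : Exponents) : Fin 5 → Fin 4 →₀ ℕ :=
  ![expo 0 0 a.a13 a.a14, expo 0 a.a2 0 0, expo 0 0 a.a3 0, expo 0 0 0 a.a4,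
    expo 0 a.a42 a.a13 0]

lemma exists_leading_le {i j k : ℕ} (h : ¬ a.IsStd i j k) :
    ∃ t, a.leading t ≤ expo 0 i j k := by
  by_contra! h'
  refine h ⟨?_, ?_, ?_, ?_, ?_⟩
  · by_contra! h1
    exact h' 2 (exponent_le (by simp [leading]) (by simp [leading]) (by simpa [leading])
      (by simp [leading]))
  · by_contra! h1
    exact h' 1 (exponent_le (by simp [leading]) (by simpa [leading]) (by simp [leading])
      (by simp [leading]))
  · by_contra! h1
    exact h' 3 (exponent_le (by simp [leading]) (by simp [leading]) (by simp [leading])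
      (by simpa [leading]))
  · rintro ⟨h1, h2⟩
    exact h' 0 (exponent_le (by simp [leading]) (by simp [leading]) (by simpa [leading])
      (by simpa [leading]))
  · rintro ⟨h1, h2⟩
    exact h' 4 (exponent_le (by simp [leading]) (by simpa [leading]) (by simpa [leading])
      (by simp [leading]))

lemma leading_zero (t : Fin 5) : a.leading t 0 = 0 := by
  fin_cases t <;> rfl

lemma leading_injective : Function.Injective a.leading := by
  have := a.a13_pos
  have := a.a14_pos
  have := a.a23_pos
  have := a.a42_pos
  have := a.a32_pos
  have := a.a34_pos
  intro s t h
  have h1 := DFunLike.congr_fun h 1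
  have h2 := DFunLike.congr_fun h 2
  have h3 := DFunLike.congr_fun h 3
  fin_cases s <;> fin_cases t <;> simp [leading, a2, a3, a4] at h1 h2 h3 ⊢ <;> omega

/-- Lowering one exponent of a leading monomial gives a normal form whose chain has length one,
whatever the sign of `a_3 - a_32 - a_34`. -/
lemma coeff_leading_X_mul (ha : Ideal.span (Set.range (a.binomials K)) = toricIdeal K n)
    {f : MvPolynomial (Fin 4) K} (hf : f ∈ orderIdeal K n) (i : Fin 4) (t : Fin 5) :
    coeff (a.leading t) (X i * f) = 0 := by
  have := a.a13_pos
  have := a.a14_pos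
  have := a.a23_pos
  have := a.a42_pos
  have := a.a32_pos
  have := a.a34_pos
  have key : ∀ i j k, a.IsStd i j k → (i < a.a32 ∨ k < a.a34) → coeff (expo 0 i j k) f = 0 :=
    fun i j k hw hik => IsStd.coeff_eq_zero_of_lt (l := 0) (a := a) (j' := j) (by simpa using hw)
      ha (by simp) hik (Or.inl rfl) hf
  fin_cases t <;> refine coeff_expo_X_mul ?_ ?_ ?_ i <;> intro hpos <;>
    first
    | exact absurd hpos (lt_irrefl 0)
    | (refine key _ _ _ ⟨?_, ?_, ?_, ?_, ?_⟩ ?_ <;> (try simp only [a2, a3, a4] at *) <;> omega)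

lemma exists_isLift_leading (hn : IsOrderCompatible n 0) (K : Type*) [Field K]
    (hb : a.IsBalanced n) {t : Fin 5} (ht : t ≠ 2) :
    ∃ g : MvPolynomial (Fin 4) K, IsLift n 0 (a.leading t) g := by
  have := a.a21_pos
  have := a.a41_pos
  fin_cases t
  · exact hn.exists_isLift K (v := expo a.a1 0 0 0) (by simpa [leading, wt_four] using hb.w1)
      (by simp [a1]; omega)
  · exact hn.exists_isLift K (v := expo a.a21 0 a.a23 0) (by simpa [leading, wt_four] using hb.w2)
      (by simpa)
  · exact absurd rfl ht
  · exact hn.exists_isLift K (v := expo a.a41 a.a42 0 0) (by simpa [leading, wt_four] using hb.w4)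
      (by simpa)
  · exact hn.exists_isLift K (v := expo a.a21 0 0 a.a34) (by simpa [leading, wt_four] using hb.w5)
      (by simpa)

lemma spanFinrank_of_lt (hn : IsOrderCompatible n 0)
    (ha : Ideal.span (Set.range (a.binomials K)) = toricIdeal K n)
    (hlt : a.a3 < a.a32 + a.a34) :
    (tangentConeIdeal (toricIdeal K n)).spanFinrank = 5 := by
  have hb := isBalanced ha
  have hex : ∀ t, ∃ g : MvPolynomial (Fin 4) K, IsLift n 0 (a.leading t) g := by
    intro t
    by_cases ht : t = 2
    · subst ht
      refine exists_isLift_of_degree_lt K 0 (v := expo 0 a.a32 0 a.a34) ?_ ?_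
      · simpa [leading, wt_four] using hb.w3
      · simpa [leading, degree_four] using hlt
    · exact exists_isLift_leading hn K hb ht
  choose g hg using hex
  refine hn.spanFinrank_tangentConeIdeal a.leading g (fun t => (hg t).mem)
    (fun t => ⟨_, (hg t).hom⟩) (fun s t => ?_) (fun f hf i t => coeff_leading_X_mul ha hf i t)
    (fun f hf => ?_)
  · rw [(hg s).coeff_eq (leading_zero t)]
    simp only [leading_injective.eq_iff]
  · have hX : (X 0 : MvPolynomial (Fin 4) K) ∈ Ideal.span (Set.range g) ⊔ Ideal.span {X 0} :=
      Ideal.mem_sup_right (Ideal.mem_span_singleton_self _)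
    refine mem_of_forall_coeff hX fun i j k h => ?_
    obtain ⟨t, ht⟩ := exists_leading_le fun hw => h (hw.coeff_eq_zero_of_degree_lt ha hlt hf)
    exact (hg t).monomial_mem (Ideal.mem_sup_left (Ideal.subset_span (Set.mem_range_self t)))
      hX ht 1

/-- f_3 is now homogeneous and free of `x_1`, so it serves as a generator although it is not a lift
of its leading monomial. All vectors of a chain have equal degree, so individual coefficients need
not vanish, only their sum along the chain. -/
lemma spanFinrank_of_eq (hn : IsOrderCompatible n 0)
    (ha : Ideal.span (Set.range (a.binomials K)) = toricIdeal K n)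
    (heq : a.a3 = a.a32 + a.a34) :
    (tangentConeIdeal (toricIdeal K n)).spanFinrank = 5 := by
  have hb := isBalanced ha
  have hpos : 0 < a.a3 := Nat.add_pos_left a.a13_pos _
  have hex : ∀ t, ∃ g : MvPolynomial (Fin 4) K, (t ≠ 2 → IsLift n 0 (a.leading t) g) ∧
      (t = 2 → g = monomial (expo 0 0 a.a3 0) 1 - monomial (expo 0 a.a32 0 a.a34) 1) := by
    intro t
    by_cases ht : t = 2
    · exact ⟨_, fun h => absurd ht h, fun _ => rfl⟩
    · obtain ⟨g, hg⟩ := exists_isLift_leading hn K hb ht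
      exact ⟨g, fun _ => hg, fun h => absurd h ht⟩
  choose g hg hg2 using hex
  replace hg2 := hg2 2 rfl
  have hd : (expo 0 0 a.a3 0).degree = (expo 0 a.a32 0 a.a34).degree := by
    simpa [degree_four] using heq
  refine hn.spanFinrank_tangentConeIdeal a.leading g (fun t => ?_)
    (fun t => ?_) (fun s t => ?_) (fun f hf i t => coeff_leading_X_mul ha hf i t)
    (fun f hf => ?_)
  · by_cases ht : t = 2
    · rw [ht, hg2]
      exact monomial_sub_mem_tangentConeIdeal (by simpa [wt_four] using hb.w3) hd
    · exact (hg t ht).mem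
  · by_cases ht : t = 2
    · rw [ht, hg2]
      exact ⟨_, (isHomogeneous_monomial _ rfl).sub (isHomogeneous_monomial _ hd.symm)⟩
    · exact ⟨_, (hg t ht).hom⟩
  · by_cases hs : s = 2
    · have h1 : expo 0 0 a.a3 0 = a.leading 2 := rfl
      have h2 : expo 0 a.a32 0 a.a34 ≠ a.leading t := by
        intro h
        have h1 := DFunLike.congr_fun h 1
        have h3 := DFunLike.congr_fun h 3
        have := a.a32_pos
        have := a.a34_pos
        fin_cases t <;> simp [leading] at h1 h3 <;> omega
      rw [hs, hg2, coeff_sub, coeff_monomial, coeff_monomial, if_neg h2, sub_zero, h1]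
      simp only [leading_injective.eq_iff]
    · rw [(hg s hs).coeff_eq (leading_zero t)]
      simp only [leading_injective.eq_iff]
  · set J := Ideal.span (Set.range g) ⊔ Ideal.span {X 0} with hJ
    have hX : (X 0 : MvPolynomial (Fin 4) K) ∈ J :=
      Ideal.mem_sup_right (Ideal.mem_span_singleton_self _)
    have hgJ : ∀ t, g t ∈ J := fun t =>
      Ideal.mem_sup_left (Ideal.subset_span (Set.mem_range_self t))
    have hred : ∀ (u : Fin 4 →₀ ℕ) (i j k l : ℕ) (c : K), a.Red i j k u l →
        monomial u c - monomial (expo 0 i j k) c ∈ J := by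
      intro u i j k l c hu
      have h1 : monomial u c - monomial (expo 0 i j k) c = monomial (expo 0 (u 1) j (u 3)) c *
          (monomial (expo 0 0 a.a3 0) 1 ^ l - monomial (expo 0 a.a32 0 a.a34) 1 ^ l) := by
        rw [monomial_pow, monomial_pow, one_pow, mul_sub, monomial_mul, monomial_mul, mul_one]
        congr 2 <;> congr 1 <;> apply exponent_ext <;>
          simp [hu.h0, ← hu.h1, hu.h2, ← hu.h3, mul_comm]
      rw [h1]
      refine Ideal.mul_mem_left _ _ ?_
      obtain ⟨q, hq⟩ := sub_dvd_pow_sub_pow (monomial (expo 0 0 a.a3 0) (1 : K))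
        (monomial (expo 0 a.a32 0 a.a34) 1) l
      rw [hq, ← hg2]
      exact Ideal.mul_mem_right _ _ (hgJ 2)
    classical
    -- Trade `x_3 ^ a_3` as often as possible. `f'` below is `f` with the terms in `x_1` dropped and
    -- each other monomial so reduced, which changes `f` only modulo `J`.
    let nf : (Fin 4 →₀ ℕ) → Fin 4 →₀ ℕ := fun u =>
      expo 0 (u 1 + a.a32 * (u 2 / a.a3)) (u 2 % a.a3) (u 3 + a.a34 * (u 2 / a.a3))
    have hnf : ∀ u, u 0 = 0 → ∀ i j k, j < a.a3 →
        (nf u = expo 0 i j k ↔ ∃ l, a.Red i j k u l) := by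
      intro u hu i j k hj
      constructor
      · intro h
        exact ⟨u 2 / a.a3, hu, DFunLike.congr_fun h 1, by
          have h2 : u 2 % a.a3 = j := DFunLike.congr_fun h 2
          rw [← h2, Nat.mod_add_div], DFunLike.congr_fun h 3⟩
      · rintro ⟨l, h0, h1, h2, h3⟩
        have hl : u 2 / a.a3 = l := by
          rw [h2, Nat.add_mul_div_left _ _ hpos, Nat.div_eq_of_lt hj, zero_add]
        have hm : u 2 % a.a3 = j := by
          rw [h2, Nat.add_mul_mod_self_left, Nat.mod_eq_of_lt hj]
        simp only [nf, hl, hm, h1, h3]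
    let f' : MvPolynomial (Fin 4) K :=
      ∑ u ∈ f.support, if u 0 = 0 then monomial (nf u) (coeff u f) else 0
    have hcoeff : ∀ w, coeff w f' = sumOn (fun u => u 0 = 0 ∧ nf u = w) f := by
      intro w
      rw [sumOn_eq_sum, coeff_sum]
      refine Finset.sum_congr rfl fun u _ => ?_
      by_cases h0 : u 0 = 0
      · simp [h0, coeff_monomial]
      · simp [h0]
    -- At a normal form the coefficient of `f'` is a chain sum, zero because `f` is in the order
    -- ideal. Any other monomial of `f'` has `x_3`-exponent below `a_3`, so it is divisible by a
    -- leading monomial that does lift.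
    have hf' : f' ∈ J := by
      refine mem_of_forall_coeff hX fun i j k h => ?_
      by_cases hw : a.IsStd i j k
      · exfalso
        apply h
        have hu : a.Red i j k (expo 0 i j k) 0 := ⟨rfl, rfl, rfl, rfl⟩
        have hred_iff : ∀ u, (u 0 = 0 ∧ nf u = expo 0 i j k) ↔ ∃ l, a.Red i j k u l := by
          intro u
          constructor
          · rintro ⟨h0, h1⟩
            exact (hnf u h0 i j k hw.j_lt).mp h1
          · rintro ⟨l, hl⟩
            exact ⟨hl.h0, (hnf u hl.h0 i j k hw.j_lt).mpr ⟨l, hl⟩⟩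
        have hdeg : ∀ u l, a.Red i j k u l → u.degree = (expo 0 i j k).degree := by
          intro u l hl
          have h0 := hl.h0
          have h1 := hl.h1
          have h2 := hl.h2
          have h3 := hl.h3
          rw [heq, add_mul] at h2
          simp [degree_four]
          omega
        have hwt : ∀ u l, a.Red i j k u l → wt n u = wt n (expo 0 i j k) := by
          intro u l hl
          have h4 := congrArg (l * ·) hb.w3
          simp only [wt_four, hl.h0, hl.h2, ← hl.h1, ← hl.h3, expo_zero, expo_one, expo_two,
            expo_three] at h4 ⊢
          linarith
        rw [hcoeff, ← hf (wt n (expo 0 i j k)) (expo 0 i j k).degree]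
        · refine sumOn_congr fun u _ => ?_
          rw [hred_iff]
          constructor
          · rintro ⟨l, hl⟩
            exact ⟨hwt u l hl, hdeg u l hl⟩
          · rintro ⟨h1, -⟩
            exact hw.red_of_wt_eq ha h1 hu
        · intro v hv
          obtain ⟨l, hl⟩ := hw.red_of_wt_eq ha hv hu
          exact (hdeg v l hl).le
      · obtain ⟨t, ht⟩ := exists_leading_le hw
        by_cases ht2 : t = 2
        · exfalso
          subst ht2
          have hj : a.a3 ≤ j := ht 2
          rw [hcoeff] at h
          refine h (sumOn_eq_zero fun u hu => ?_)
          have h2 : u 2 % a.a3 = j := DFunLike.congr_fun hu.2 2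
          have := Nat.mod_lt (u 2) hpos
          omega
        · exact (hg t ht2).monomial_mem (hgJ t) hX ht 1
    have hsub : f - f' ∈ J := by
      have h1 : f - f' = ∑ u ∈ f.support, (monomial u (coeff u f) -
          if u 0 = 0 then monomial (nf u) (coeff u f) else 0) := by
        rw [Finset.sum_sub_distrib, ← f.as_sum]
      rw [h1]
      refine Ideal.sum_mem _ fun u _ => ?_
      split_ifs with h0
      · exact hred u _ _ _ (u 2 / a.a3) _ ⟨h0, rfl, (Nat.mod_add_div _ _).symm, rfl⟩
      · rw [sub_zero]
        exact monomial_mem_of_pos hX (Nat.pos_of_ne_zero h0) _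
    rw [← sub_add_cancel f f']
    exact add_mem hsub hf'

end Exponents
end MonomialCurve

/-! ### The case a_3 > a_32 + a_34 -/

namespace MonomialCurve
open MvPolynomial
namespace Exponents

variable {a : Exponents} {K : Type*} [Field K] {n : Fin 4 → ℕ}

/-- Put `D = d - 1`: since `a_2 = a_32 + a_42` and `a_4 = a_14 + a_34`, removing one multiple turns
the conditions on `d` into conditions on `a_42` and `a_14`. Positivity of the exponents rules out `d
≤ 1`. -/
lemma d_spec (a : Exponents) :
    ∃ D, a.d = D + 1 ∧ 0 < D ∧ (a.a42 ≤ D * a.a32 ∨ a.a14 ≤ D * a.a34) ∧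
      ∀ i < D, i * a.a32 < a.a42 ∧ i * a.a34 < a.a14 := by
  set S := {i : ℕ | (a.a2 : ℤ) - i * a.a32 ≤ 0} ∪ {i : ℕ | (a.a4 : ℤ) - i * a.a34 ≤ 0} with hS
  have hmem : ∀ i, i ∈ S ↔ (a.a2 ≤ i * a.a32 ∨ a.a4 ≤ i * a.a34) := by
    intro i
    simp only [hS, Set.mem_union, Set.mem_ofPred_eq, sub_nonpos]
    norm_cast
  have h1 : a.d ∈ S := Nat.sInf_mem ⟨a.a2, (hmem _).mpr
    (Or.inl (Nat.le_mul_of_pos_right _ a.a32_pos))⟩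
  have h2 : ∀ i < a.d, i ∉ S := fun i hi => Nat.notMem_of_lt_sInf hi
  rw [hmem] at h1
  simp only [hmem, a2, a4] at h1 h2
  have p1 := a.a32_pos
  have p2 := a.a42_pos
  have p3 := a.a14_pos
  have p4 := a.a34_pos
  have hd : 2 ≤ a.d := by
    by_contra h
    have : a.d = 0 ∨ a.d = 1 := by omega
    rcases this with h | h <;> rw [h] at h1 <;> simp at h1 <;> omega
  refine ⟨a.d - 1, by omega, by omega, ?_, fun i hi => ?_⟩
  · rw [show a.d = (a.d - 1) + 1 by omega, add_mul, add_mul] at h1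
    omega
  · have h3 := h2 (i + 1) (by omega)
    rw [add_mul, add_mul] at h3
    omega

/-- The exponents of the minimal generators of the tangent cone ideal modulo `x_1`, in the case
`a_32 + a_34 < a_3`. -/
def coneExponents (a : Exponents) (D : ℕ) : Fin 4 ⊕ (Fin D ⊕ Fin D) → Fin 4 →₀ ℕ :=
  Sum.elim ![expo 0 a.a2 0 0, expo 0 0 0 a.a4, expo 0 a.a32 0 a.a34,
      expo 0 0 (a.a13 + a.a3 * D) 0]
    (Sum.elim (fun i => expo 0 (a.a42 - a.a32 * i) (a.a13 + a.a3 * i) 0)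
      (fun i => expo 0 0 (a.a13 + a.a3 * i) (a.a14 - a.a34 * i)))

lemma coneExponents_zero {D : ℕ} (t : Fin 4 ⊕ (Fin D ⊕ Fin D)) : a.coneExponents D t 0 = 0 := by
  rcases t with t | t | t
  · fin_cases t <;> rfl
  · rfl
  · rfl

lemma coneExponents_injective {D : ℕ} (hD : ∀ i < D, a.a32 * i < a.a42 ∧ a.a34 * i < a.a14) :
    Function.Injective (a.coneExponents D) := by
  have p1 := a.a13_pos
  have p2 := a.a32_pos
  have p3 := a.a34_pos
  have p4 := a.a42_pos
  have p5 := a.a14_pos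
  have hinj : ∀ i i' : Fin D, a.a3 * i = a.a3 * i' → i = i' := fun i i' h =>
    Fin.ext (Nat.eq_of_mul_eq_mul_left (Nat.add_pos_left p1 _) h)
  intro s t h
  have h1 := DFunLike.congr_fun h 1
  have h2 := DFunLike.congr_fun h 2
  have h3 := DFunLike.congr_fun h 3
  rcases s with s | s | s <;> rcases t with t | t | t
  · fin_cases s <;> fin_cases t <;> simp [coneExponents, a2, a4] at h1 h2 h3 ⊢ <;> omega
  · have := hD t t.2
    fin_cases s <;> simp [coneExponents, a2, a4] at h1 h2 h3 ⊢ <;> omega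
  · have := hD t t.2
    fin_cases s <;> simp [coneExponents, a2, a4] at h1 h2 h3 ⊢ <;> omega
  · have := hD s s.2
    fin_cases t <;> simp [coneExponents, a2, a4] at h1 h2 h3 ⊢ <;> omega
  · rw [hinj s t (by simpa [coneExponents] using h2)]
  · have := hD s s.2
    simp [coneExponents] at h1
    omega
  · have := hD s s.2
    fin_cases t <;> simp [coneExponents, a2, a4] at h1 h2 h3 ⊢ <;> omega
  · have := hD t t.2
    simp [coneExponents] at h1
    omega
  · rw [hinj s t (by simpa [coneExponents] using h2)]

/-- Lowering one exponent gives the last vector of the chain of a normal form. For exponents with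
`x_3`-part `a_13 + a_3 l` this vector sits at position `l`, and the normal form has `x_3`-exponent
`a_13` or, if `x_3` was lowered, `a_13 - 1`. -/
lemma coeff_coneExponents_X_mul (ha : Ideal.span (Set.range (a.binomials K)) = toricIdeal K n)
    (hlt : a.a32 + a.a34 < a.a3) {D : ℕ} (hD0 : 0 < D)
    (hD : ∀ i < D, a.a32 * i < a.a42 ∧ a.a34 * i < a.a14)
    {f : MvPolynomial (Fin 4) K} (hf : f ∈ orderIdeal K n) (i : Fin 4)
    (t : Fin 4 ⊕ (Fin D ⊕ Fin D)) : coeff (a.coneExponents D t) (X i * f) = 0 := by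
  have p1 := a.a13_pos
  have p2 := a.a32_pos
  have p3 := a.a34_pos
  have p4 := a.a42_pos
  have p5 := a.a14_pos
  have p6 := a.a23_pos
  have key : ∀ i j k j' l, j = j' + a.a3 * l → a.IsStd (i + a.a32 * l) j' (k + a.a34 * l) →
      (i < a.a32 ∨ k < a.a34) → coeff (expo 0 i j k) f = 0 :=
    fun i j k j' l hj hw hik => hw.coeff_eq_zero_of_lt ha hj hik (Or.inr hlt) hf
  have hlast : a.a32 * D < a.a2 ∧ a.a34 * D < a.a4 := by
    have h := hD (D - 1) (by omega)
    obtain ⟨D', rfl⟩ : ∃ D', D = D' + 1 := ⟨D - 1, by omega⟩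
    rw [Nat.add_sub_cancel] at h
    simp only [mul_add, a2, a4]
    omega
  rcases t with t | t | t
  · fin_cases t <;> refine coeff_expo_X_mul ?_ ?_ ?_ i <;> intro hpos <;>
      first
      | exact absurd hpos (lt_irrefl 0)
      | (refine key _ _ _ _ 0 rfl ⟨?_, ?_, ?_, ?_, ?_⟩ ?_ <;>
          (try simp only [a2, a3, a4] at *) <;> omega)
      | (refine key _ _ _ (a.a13 - 1) D (by omega) ⟨?_, ?_, ?_, ?_, ?_⟩ ?_ <;>
          (try simp only [a2, a3, a4] at *) <;> omega)
  · have ht := hD t t.2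
    refine coeff_expo_X_mul ?_ ?_ ?_ i <;> intro hpos <;>
      first
      | exact absurd hpos (lt_irrefl 0)
      | (refine key _ _ _ a.a13 t (by omega) ⟨?_, ?_, ?_, ?_, ?_⟩ ?_ <;>
          (try simp only [a2, a3, a4] at *) <;> omega)
      | (refine key _ _ _ (a.a13 - 1) t (by omega) ⟨?_, ?_, ?_, ?_, ?_⟩ ?_ <;>
          (try simp only [a2, a3, a4] at *) <;> omega)
  · have ht := hD t t.2
    refine coeff_expo_X_mul ?_ ?_ ?_ i <;> intro hpos <;>
      first
      | exact absurd hpos (lt_irrefl 0)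
      | (refine key _ _ _ a.a13 t (by omega) ⟨?_, ?_, ?_, ?_, ?_⟩ ?_ <;>
          (try simp only [a2, a3, a4] at *) <;> omega)
      | (refine key _ _ _ (a.a13 - 1) t (by omega) ⟨?_, ?_, ?_, ?_, ?_⟩ ?_ <;>
          (try simp only [a2, a3, a4] at *) <;> omega)

lemma exists_isLift_coneExponents (hn : IsOrderCompatible n 0) (K : Type*) [Field K]
    (hb : a.IsBalanced n) (hlt : a.a32 + a.a34 < a.a3) {D : ℕ}
    (hD1 : a.a42 ≤ a.a32 * D ∨ a.a14 ≤ a.a34 * D)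
    (hD : ∀ i < D, a.a32 * i < a.a42 ∧ a.a34 * i < a.a14) (t : Fin 4 ⊕ (Fin D ⊕ Fin D)) :
    ∃ g : MvPolynomial (Fin 4) K, IsLift n 0 (a.coneExponents D t) g := by
  have p21 := a.a21_pos
  have p41 := a.a41_pos
  -- For exponents with `x_3`-part `a_13 + a_3 l`, the witnesses come from trading `x_3 ^ (a_3 l)`
  -- by f_3 and then applying f_5 or f_1, which brings in `x_1`. For `l = D` the choice depends on
  -- which of `a_42`, `a_14` is exhausted, and `e` is what remains.
  have h3 : ∀ l, a.a3 * l * n 2 = a.a32 * l * n 1 + a.a34 * l * n 3 := fun l => by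
    linear_combination l * hb.w3
  have h1 := hb.w1
  have h5 := hb.w5
  rcases t with t | t | t
  · fin_cases t
    · exact hn.exists_isLift K (v := expo a.a21 0 a.a23 0)
        (by simpa [coneExponents, wt_four] using hb.w2) (by simpa)
    · exact hn.exists_isLift K (v := expo a.a41 a.a42 0 0)
        (by simpa [coneExponents, wt_four] using hb.w4) (by simpa)
    · exact exists_isLift_of_degree_lt K 0 (v := expo 0 0 a.a3 0)
        (by simpa [coneExponents, wt_four] using hb.w3.symm)
        (by simpa [coneExponents, degree_four] using hlt)
    · rcases hD1 with hD1 | hD1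
      · obtain ⟨e, he⟩ := Nat.exists_eq_add_of_le hD1
        refine hn.exists_isLift K (v := expo a.a21 e 0 (a.a34 + a.a34 * D)) ?_ (by simpa)
        have := h3 D
        rw [he] at this
        simp [coneExponents, wt_four]
        linarith
      · obtain ⟨e, he⟩ := Nat.exists_eq_add_of_le hD1
        refine hn.exists_isLift K (v := expo a.a1 (a.a32 * D) 0 e) ?_ (by simp [a1]; omega)
        have := h3 D
        rw [he] at this
        simp [coneExponents, wt_four]
        linarith
  · obtain ⟨e, he⟩ := Nat.exists_eq_add_of_le (hD t t.2).1.le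
    refine hn.exists_isLift K (v := expo a.a21 0 0 (a.a34 + a.a34 * t)) ?_ (by simpa)
    have := h3 t
    have he' : a.a42 - a.a32 * t = e := by omega
    rw [he] at h5
    simp [coneExponents, wt_four, he']
    linarith
  · obtain ⟨e, he⟩ := Nat.exists_eq_add_of_le (hD t t.2).2.le
    refine hn.exists_isLift K (v := expo a.a1 (a.a32 * t) 0 0) ?_ (by simp [a1]; omega)
    have := h3 t
    have he' : a.a14 - a.a34 * t = e := by omega
    rw [he] at h1
    simp [coneExponents, wt_four, he']
    linarith

/-- If no listed exponent divides, `x_2 ^ a_32 x_4 ^ a_34` does not, so no trade is left. The two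
families, read at `l = j / a_3` and at `l - 1`, give the bounds in `IsStd`; the index `l - 1` is
admissible because `a_13 < a_3`. -/
lemma exists_coneExponents_le {D : ℕ} {i j k : ℕ}
    (h : ¬ (a.IsStd (i + a.a32 * (j / a.a3)) (j % a.a3) (k + a.a34 * (j / a.a3)) ∧
      (i < a.a32 ∨ k < a.a34))) :
    ∃ t, a.coneExponents D t ≤ expo 0 i j k := by
  have hpos : 0 < a.a3 := Nat.add_pos_left a.a13_pos _
  have p13 : a.a13 < a.a3 := Nat.lt_add_of_pos_right a.a23_pos
  have hj := Nat.mod_add_div j a.a3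
  have hm := Nat.mod_lt j hpos
  set l := j / a.a3
  set m := j % a.a3
  by_contra! h'
  have e2 : ¬ (a.a32 ≤ i ∧ a.a34 ≤ k) := fun h1 =>
    h' (Sum.inl 2) (exponent_le le_rfl h1.1 (Nat.zero_le _) h1.2)
  have e0 : ¬ a.a2 ≤ i := fun h1 =>
    h' (Sum.inl 0) (exponent_le le_rfl h1 (Nat.zero_le _) (Nat.zero_le _))
  have e1 : ¬ a.a4 ≤ k := fun h1 =>
    h' (Sum.inl 1) (exponent_le le_rfl (Nat.zero_le _) (Nat.zero_le _) h1)
  have e3 : ¬ a.a13 + a.a3 * D ≤ j := fun h1 =>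
    h' (Sum.inl 3) (exponent_le le_rfl (Nat.zero_le _) h1 (Nat.zero_le _))
  have hlD : ∀ s, a.a13 + a.a3 * s ≤ j → s < D := by
    intro s hs
    by_contra! hsD
    exact e3 ((Nat.add_le_add_left (Nat.mul_le_mul_left _ hsD) _).trans hs)
  have e4 : ∀ s, a.a13 + a.a3 * s ≤ j → i + a.a32 * s < a.a42 := by
    intro s hs
    by_contra! h1
    exact h' (Sum.inr (Sum.inl ⟨s, hlD s hs⟩))
      (exponent_le le_rfl (Nat.sub_le_iff_le_add.mpr h1) hs (Nat.zero_le _))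
  have e5 : ∀ s, a.a13 + a.a3 * s ≤ j → k + a.a34 * s < a.a14 := by
    intro s hs
    by_contra! h1
    exact h' (Sum.inr (Sum.inr ⟨s, hlD s hs⟩))
      (exponent_le le_rfl (Nat.zero_le _) hs (Nat.sub_le_iff_le_add.mpr h1))
  refine h ⟨⟨hm, ?_, ?_, ?_, ?_⟩, by omega⟩
  · by_contra h1
    rcases Nat.eq_zero_or_pos l with h0 | h0
    · rw [h0] at h1; simp at h1; omega
    · obtain ⟨l', hl'⟩ : ∃ l', l = l' + 1 := ⟨l - 1, by omega⟩
      rw [hl', mul_add] at h1 hj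
      have := e4 l' (by omega)
      simp only [a2] at h1
      omega
  · by_contra h1
    rcases Nat.eq_zero_or_pos l with h0 | h0
    · rw [h0] at h1; simp at h1; omega
    · obtain ⟨l', hl'⟩ : ∃ l', l = l' + 1 := ⟨l - 1, by omega⟩
      rw [hl', mul_add] at h1 hj
      have := e5 l' (by omega)
      simp only [a4] at h1
      omega
  · rintro ⟨h1, h2⟩
    have := e5 l (by omega)
    omega
  · rintro ⟨h1, h2⟩
    have := e4 l (by omega)
    omega

lemma spanFinrank_of_gt (hn : IsOrderCompatible n 0)
    (ha : Ideal.span (Set.range (a.binomials K)) = toricIdeal K n)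
    (hlt : a.a32 + a.a34 < a.a3) :
    (tangentConeIdeal (toricIdeal K n)).spanFinrank = 2 * a.d + 2 := by
  obtain ⟨D, hd, hD0, hD1, hD⟩ := d_spec a
  simp only [mul_comm _ a.a32, mul_comm _ a.a34] at hD1 hD
  choose g hg using exists_isLift_coneExponents hn K (isBalanced ha) hlt hD1 hD
  -- Four single generators and two families of length `d - 1`.
  have hcard : Fintype.card (Fin 4 ⊕ (Fin D ⊕ Fin D)) = 2 * a.d + 2 := by
    simp [hd]; ring
  rw [← hcard]
  refine hn.spanFinrank_tangentConeIdeal (a.coneExponents D) g (fun t => (hg t).mem)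
    (fun t => ⟨_, (hg t).hom⟩) (fun s t => ?_)
    (fun f hf i t => coeff_coneExponents_X_mul ha hlt hD0 hD hf i t) (fun f hf => ?_)
  · rw [(hg s).coeff_eq (coneExponents_zero t)]
    simp only [(coneExponents_injective hD).eq_iff]
  · have hX : (X 0 : MvPolynomial (Fin 4) K) ∈ Ideal.span (Set.range g) ⊔ Ideal.span {X 0} :=
      Ideal.mem_sup_right (Ideal.mem_span_singleton_self _)
    refine mem_of_forall_coeff hX fun i j k h => ?_
    obtain ⟨t, ht⟩ := exists_coneExponents_le (a := a) (D := D) (i := i) (j := j) (k := k)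
      fun hw => h (hw.1.coeff_eq_zero_of_lt ha (Nat.mod_add_div j a.a3).symm hw.2
        (Or.inr hlt) hf)
    exact (hg t).monomial_mem (Ideal.mem_sup_left (Ideal.subset_span (Set.mem_range_self t)))
      hX ht 1

end Exponents
end MonomialCurve
end

theorem mainTheorem3 {K : Type*} [Field K] (n : Fin 4 → ℕ)
    (hpos : ∀ i, 0 < n i) (hdist : Function.Injective n) (hgcd : Finset.univ.gcd n = 1)
    (hmin : ∀ i, n 0 ≤ n i)
    (hGor : IsGorensteinLocalRing (MonomialCurve.localRing K n))
    (hnci : ¬ MonomialCurve.IsCompleteIntersection K n)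
    (a : MonomialCurve.Exponents)
    (ha : MinimallyGenerates (a.binomials K) (MonomialCurve.toricIdeal K n))
    (hCM : IsCohenMacaulayRing (AssocGradedRing (MonomialCurve.maxIdeal K n))) :
    (a.a3 ≤ a.a32 + a.a34 →
      (MonomialCurve.tangentConeIdeal (MonomialCurve.toricIdeal K n)).spanFinrank = 5) ∧
    (a.a32 + a.a34 < a.a3 →
      (MonomialCurve.tangentConeIdeal (MonomialCurve.toricIdeal K n)).spanFinrank =
        2 * a.d + 2) := by
  have hlt : ∀ i, i ≠ 0 → n 0 < n i := fun i hi =>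
    (hmin i).lt_of_ne fun h => hi (hdist h).symm
  have hn : MonomialCurve.IsOrderCompatible n 0 := fun u v huv =>
    MonomialCurve.exists_degree_of_isCohenMacaulayRing hpos hlt hCM huv
  refine ⟨fun h => ?_, fun h => MonomialCurve.Exponents.spanFinrank_of_gt hn ha.1 h⟩
  rcases h.lt_or_eq with h | h
  · exact MonomialCurve.Exponents.spanFinrank_of_lt hn ha.1 h
  · exact MonomialCurve.Exponents.spanFinrank_of_eq hn ha.1 h
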